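/- **Setting (the language Qunity).** Fix a set $\mathbb X$ of variables. *Syntax.* Data types: $T ::= \mathtt{Void}\mid \mathtt{()}\mid T\oplus T\mid T\otimes T$, with $\mathtt{Bit}:=\mathtt{()}\oplus\mathtt{()}$. Expressions and programs ($r,\theta,\phi,\lambda\in\mathbb R$, $x\in\mathbb X$, $n\ge 0$): $$e ::= \mathtt{()}\mid x\mid (e,e)\mid \mathtt{ctrl}_{T,T'}\ e\ \{e_1\mapsto e_1',\dots,e_n\mapsto e_n'\}\mid \mathtt{try}\ e\ \mathtt{catch}\ e\mid f\,e,$$ $$f ::= \mathtt{u_3}(\theta,\phi,\lambda)\mid \mathtt{left}_{T_0,T_1}\mid \mathtt{right}_{T_0,T_1}\mid \lambda e\overset{T}{\mapsto} e'\mid \mathtt{rphase}_T(e;r,r').$$ $\mathrm{FV}(e)$ is the set of all variables occurring in $e$ outside programs $f$, and $\mathtt{gphase}_T(r):=\mathtt{rphase}_T(y;r,r)$ for a variable $y$. A context is a finite list of pairs $x:T$; $\mathrm{dom}$ is its set of variables. All contexts occurring in the rules (including concatenations $\Gamma,\Gamma'$) have pairwise distinct variables. $\pi$ denotes list permutations.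 *Spanning and orthogonality.* $\mathrm{span}_T(e_1,\dots,e_n)$ is generated by: $\mathrm{span}_{\mathtt{Void}}()$; $\mathrm{span}_{\mathtt{()}}(\mathtt{()})$; $\mathrm{span}_T(x)$; if $\mathrm{span}_T(e_1,\dots,e_n)$ and $\mathrm{span}_{T'}(e_1',\dots,e_{n'}')$ then $\mathrm{span}_{T\oplus T'}(\mathtt{left}_{T,T'}e_1,\dots,\mathtt{left}_{T,T'}e_n,\mathtt{right}_{T,T'}e_1',\dots,\mathtt{right}_{T,T'}e'_{n'})$; if $\mathrm{span}_T(e_1,\dots,e_m)$ and, for all $j$, $\mathrm{span}_{T'}(e'_{j,1},\dots,e'_{j,n_j})$ with $\mathrm{FV}(e_j)\cap\bigcup_k\mathrm{FV}(e'_{j,k})=\varnothing$, then $\mathrm{span}_{T\otimes T'}$ of all the pairs $(e_j,e'_{j,k})$ in lexicographic order of $(j,k)$; closure under permutation of the list. $\mathrm{ortho}_T(\vec e)$ means that $\vec e$ is a subsequence of some $\vec e\,'$ with $\mathrm{span}_T(\vec e\,')$. *Erasure.* $\mathrm{erases}_T(x;e_1,\dots,e_n)$ is generated by: $\mathrm{erases}_T(x;x,\dots,x)$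 (any number, also zero, of copies); one $e_j$ may be replaced by $\mathtt{gphase}_T(r)\,e_j$; if $\mathrm{erases}_T(x;\vec a,e_{1}'',\dots,e_{m}'',\vec c)$ and the patterns $e_1',\dots,e_m'$ do not bind $x$, i.e. $x\notin \mathrm{FV}(e_i')$ for all $i$, then $\mathrm{erases}_T(x;\vec a,\mathtt{ctrl}_{T',T}\,e\,\{e_i'\mapsto e_i''\}_{i=1}^m,\vec c)$; if $\mathrm{erases}_{T_0}(x;e_{0,1},\dots,e_{0,n})$ or $\mathrm{erases}_{T_1}(x;e_{1,1},\dots,e_{1,n})$ then $\mathrm{erases}_{T_0\otimes T_1}(x;(e_{0,1},e_{1,1}),\dots,(e_{0,n},e_{1,n}))$. *Values and Hilbert spaces.* $\mathbb V(\mathtt{Void})=\varnothing$, $\mathbb V(\mathtt{()})=\{\mathtt{()}\}$, $\mathbb V(T_0\oplus T_1)=\{\mathtt{left}\,v_0\}\cup\{\mathtt{right}\,v_1\}$, $\mathbb V(T_0\otimes T_1)=\{(v_0,v_1)\}$ with $v_i\in\mathbb V(T_i)$. A valuation in $\mathbb V(x_1:T_1,\dots,x_n:T_n)$ assigns to each binding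 $x_i:T_i$ a value in $\mathbb V(T_i)$. $\mathcal H(T)$ and $\mathcal H(\Delta)$ are the finite-dimensional complex Hilbert spaces with orthonormal bases $\{|v\rangle:v\in\mathbb V(T)\}$ and $\{|\tau\rangle:\tau\in\mathbb V(\Delta)\}$ (direct sums and tensor products along $\oplus$, $\otimes$ and the comma). $\mathcal L(\mathcal H,\mathcal H')$ is the space of linear operators, $\mathcal L(\mathcal H):=\mathcal L(\mathcal H,\mathcal H)$. *Typing and semantics.* There are four mutually inductive judgments: pure expressions $\Gamma\parallel\Delta\vdash e:T$, mixed expressions $\Delta\Vdash e:T$, pure programs $\vdash f:T\rightsquigarrow T'$, and mixed programs $\vdash f:T\Rrightarrow T'$. A denotation is defined by recursion on typing derivations: for $\sigma\in\mathbb V(\Gamma)$, $[\![\sigma:\Gamma\parallel\Delta\vdash e:T]\!]\in\mathcal L(\mathcal H(\Delta),\mathcal H(T))$; $[\![\Delta\Vdash e:T]\!]\in\mathcal L(\mathcal L(\mathcal H(\Delta)),\mathcal L(\mathcal H(T)))$; $[\![\vdash f:T\rightsquigarrow T']\!]\in\mathcal L(\mathcal H(T),\mathcal H(T'))$; $[\![\vdash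 f:T\Rrightarrow T']\!]\in\mathcal L(\mathcal L(\mathcal H(T)),\mathcal L(\mathcal H(T')))$. The rules are given with the denotation on basis elements, extended linearly; we abbreviate denotations by $[\![e]\!]_\sigma$, $[\![e]\!]$, $[\![f]\!]$, and $[\![e]\!]_\varnothing$ is the pure denotation with empty classical context. Pure expressions: - $\Gamma\parallel\varnothing\vdash\mathtt{()}:\mathtt{()}$, with $|\varnothing\rangle\mapsto|\mathtt{()}\rangle$; $\ \Gamma,x:T,\Gamma'\parallel\varnothing\vdash x:T$, with $|\varnothing\rangle\mapsto|\sigma(x)\rangle$; $\ \Gamma\parallel x:T\vdash x:T$ if $x\notin\mathrm{dom}(\Gamma)$, with $|x\mapsto v\rangle\mapsto|v\rangle$. - If $\Gamma\parallel\Delta,\Delta_0\vdash e_0:T_0$ and $\Gamma\parallel\Delta,\Delta_1\vdash e_1:T_1$, then $\Gamma\parallel\Delta,\Delta_0,\Delta_1\vdash(e_0,e_1):T_0\otimes T_1$, with $|\tau,\tau_0,\tau_1\rangle\mapsto[\![e_0]\!]_\sigma|\tau,\tau_0\rangle\otimes[\![e_1]\!]_\sigma|\tau,\tau_1\rangle$.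 - If $\Gamma,\Delta\Vdash e:T$, $\mathrm{ortho}_T(e_1,\dots,e_n)$, $\varnothing\parallel\Gamma_j\vdash e_j:T$ and $\Gamma,\Gamma',\Gamma_j\parallel\Delta,\Delta'\vdash e_j':T'$ for all $j$, and $\mathrm{erases}_{T'}(x;e_1',\dots,e_n')$ for all $x\in\mathrm{dom}(\Delta)$, then $\Gamma,\Gamma'\parallel\Delta,\Delta'\vdash\mathtt{ctrl}_{T,T'}\,e\,\{e_j\mapsto e_j'\}_{j=1}^n:T'$, with $$|\tau,\tau'\rangle\mapsto\sum_{v\in\mathbb V(T)}\langle v|[\![e]\!](|\sigma,\tau\rangle\langle\sigma,\tau|)|v\rangle\sum_{j=1}^n\sum_{\sigma_j\in\mathbb V(\Gamma_j)}\langle\sigma_j|[\![e_j]\!]_\varnothing^\dagger|v\rangle\,[\![e_j']\!]_{\sigma,\sigma',\sigma_j}|\tau,\tau'\rangle .$$ - If $\vdash f:T\rightsquigarrow T'$ and $\Gamma\parallel\Delta\vdash e:T$, then $\Gamma\parallel\Delta\vdash f\,e:T'$, with denotation $[\![f]\!][\![e]\!]_\sigma$. - If $\Gamma\parallel\Delta\vdash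 e:T$, then $\pi_g(\Gamma)\parallel\pi_d(\Delta)\vdash e:T$; its denotation at $\pi_g(\sigma)$ maps $|\pi_d(\tau)\rangle\mapsto[\![e]\!]_\sigma|\tau\rangle$. Mixed expressions: - If $\varnothing\parallel\Delta\vdash e:T$, then $\Delta\Vdash e:T$, with $|\tau\rangle\langle\tau'|\mapsto[\![e]\!]_\varnothing|\tau\rangle\langle\tau'|[\![e]\!]_\varnothing^\dagger$. - If $\Delta\Vdash e:T$, then $\pi(\Delta)\Vdash e:T$, with $|\pi(\tau)\rangle\langle\pi(\tau')|\mapsto[\![e]\!](|\tau\rangle\langle\tau'|)$. - If $\Delta,\Delta_i\Vdash e_i:T_i$ for $i=0,1$, then $\Delta,\Delta_0,\Delta_1\Vdash(e_0,e_1):T_0\otimes T_1$, with $|\tau,\tau_0,\tau_1\rangle\langle\tau',\tau_0',\tau_1'|\mapsto[\![e_0]\!](|\tau,\tau_0\rangle\langle\tau',\tau_0'|)\otimes[\![e_1]\!](|\tau,\tau_1\rangle\langle\tau',\tau_1'|)$. - If $\Delta_0\Vdash e_0:T$ and $\Delta_1\Vdash e_1:T$, then $\Delta_0,\Delta_1\Vdash\mathtt{try}\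 e_0\ \mathtt{catch}\ e_1:T$, with, for $\rho_i=|\tau_i\rangle\langle\tau_i'|$, $\ \rho_0\otimes\rho_1\mapsto\mathrm{tr}(\rho_1)\,[\![e_0]\!](\rho_0)+\bigl(\mathrm{tr}(\rho_0)-\mathrm{tr}([\![e_0]\!](\rho_0))\bigr)\,[\![e_1]\!](\rho_1)$. - If $\vdash f:T\Rrightarrow T'$ and $\Delta\Vdash e:T$, then $\Delta\Vdash f\,e:T'$, with denotation $[\![f]\!]\circ[\![e]\!]$. Pure programs: - $\vdash\mathtt{u_3}(\theta,\phi,\lambda):\mathtt{Bit}\rightsquigarrow\mathtt{Bit}$, with $|\mathtt 0\rangle\mapsto\cos\frac\theta2|\mathtt 0\rangle+e^{i\phi}\sin\frac\theta2|\mathtt 1\rangle$ and $|\mathtt 1\rangle\mapsto-e^{i\lambda}\sin\frac\theta2|\mathtt 0\rangle+e^{i(\phi+\lambda)}\cos\frac\theta2|\mathtt 1\rangle$, where $\mathtt 0=\mathtt{left}\,\mathtt{()}$, $\mathtt 1=\mathtt{right}\,\mathtt{()}$. - $\vdash\mathtt{left}_{T_0,T_1}:T_0\rightsquigarrow T_0\oplus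 T_1$ and $\vdash\mathtt{right}_{T_0,T_1}:T_1\rightsquigarrow T_0\oplus T_1$, with $|v\rangle\mapsto|\mathtt{left}\,v\rangle$, resp. $|v\rangle\mapsto|\mathtt{right}\,v\rangle$. - If $\varnothing\parallel\Delta\vdash e:T$ and $\varnothing\parallel\Delta\vdash e':T'$, then $\vdash\lambda e\overset{T}{\mapsto}e':T\rightsquigarrow T'$, with denotation $[\![e']\!]_\varnothing[\![e]\!]_\varnothing^\dagger$. - If $\varnothing\parallel\Delta\vdash e:T$, then $\vdash\mathtt{rphase}_T(e;r,r'):T\rightsquigarrow T$, with denotation $e^{ir}[\![e]\!]_\varnothing[\![e]\!]_\varnothing^\dagger+e^{ir'}(I-[\![e]\!]_\varnothing[\![e]\!]_\varnothing^\dagger)$. Mixed programs: - If $\vdash f:T\rightsquigarrow T'$, then $\vdash f:T\Rrightarrow T'$, with $|v\rangle\langle v'|\mapsto[\![f]\!]|v\rangle\langle v'|[\![f]\!]^\dagger$, where $[\![f]\!]$ is the pure denotation. - If $\varnothing\parallel\Delta,\Delta_0\vdash e:T$ and $\Delta\Vdash e':T'$, then $\vdash\lambda e\overset{T}{\mapsto}e':T\Rrightarrow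 T'$, with $|v\rangle\langle v'|\mapsto[\![e']\!]\bigl(\mathrm{tr}_{\Delta_0}([\![e]\!]_\varnothing^\dagger|v\rangle\langle v'|[\![e]\!]_\varnothing)\bigr)$. A *Kraus operator* is a linear operator $E$ with $E^\dagger E\sqsubseteq I$ in the Löwner order ($I-E^\dagger E$ is positive semidefinite). A superoperator $\Phi$ is *completely positive* if $\mathrm{id}_k\otimes\Phi$ preserves positive semidefiniteness for all $k$, and *trace-non-increasing* if $\mathrm{tr}\,\Phi(\rho)\le\mathrm{tr}\,\rho$ for all positive semidefinite $\rho$. **Theorem.** For every derivation of $\Gamma\parallel\Delta\vdash e:T$ and every $\sigma\in\mathbb V(\Gamma)$, $[\![\sigma:\Gamma\parallel\Delta\vdash e:T]\!]$ is a Kraus operator; for every derivation of $\vdash f:T\rightsquigarrow T'$, $[\![\vdash f:T\rightsquigarrow T']\!]$ is a Kraus operator; for all derivations of $\Delta\Vdash e:T$ and of $\vdash f:T\Rrightarrow T'$, the superoperators $[\![\Delta\Vdash e:T]\!]$ and $[\![\vdash f:T\Rrightarrow T']\!]$ are completely positive and trace-non-increasing. -/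

import Mathlib

open scoped ComplexOrder Matrix Kronecker

noncomputable section

namespace Qunity

universe u

/-! ### Syntax -/

/-- Data types `T`. -/
inductive Ty : Type
  | void : Ty
  | unit : Ty
  | sum : Ty → Ty → Ty
  | prod : Ty → Ty → Ty

/-- The type of qubits, `() ⊕ ()`. -/
abbrev Ty.bit : Ty := Ty.sum Ty.unit Ty.unit

mutual
/-- Expressions `e`, with variables taken from `X`. In `ctrl e T p b T'` the branches are
`p j ↦ b j` for `j : Fin n` (there may be none). -/
inductive Exp (X : Type u) : Type u
  | unit : Exp X
  | var : X → Exp X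
  | pair : Exp X → Exp X → Exp X
  | ctrl {n : ℕ} (e : Exp X) (T : Ty) (p b : Fin n → Exp X) (T' : Ty) : Exp X
  | tryCatch : Exp X → Exp X → Exp X
  | app : Prog X → Exp X → Exp X
/-- Programs `f`. -/
inductive Prog (X : Type u) : Type u
  | u3 (rθ rφ rl : ℝ) : Prog X
  | left (T₀ T₁ : Ty) : Prog X
  | right (T₀ T₁ : Ty) : Prog X
  | lam (e : Exp X) (T : Ty) (e' : Exp X) : Prog X
  | rphase (T : Ty) (e : Exp X) (r r' : ℝ) : Prog X
end

/-- The global phase program: `rphase` on a variable pattern with twice the same angle. -/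
def Prog.gphase {X : Type u} (T : Ty) (y : X) (r : ℝ) : Prog X :=
  Prog.rphase T (Exp.var y) r r

/-- The variables of an expression. Expressions have no binders, and programs are closed. -/
def Exp.fv {X : Type u} : Exp X → Set X
  | .unit => ∅
  | .var x => {x}
  | .pair e₀ e₁ => e₀.fv ∪ e₁.fv
  | .ctrl e _ p b _ => e.fv ∪ ⋃ j, ((p j).fv ∪ (b j).fv)
  | .tryCatch e₀ e₁ => e₀.fv ∪ e₁.fv
  | .app _ e => e.fv

/-- Typing contexts: ordered lists of variable-type pairs. -/
abbrev Ctx (X : Type u) : Type u := List (X × Ty)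

/-- The domain of a context. -/
def Ctx.dom {X : Type u} (Γ : Ctx X) : List X := Γ.map Prod.fst

/-- A context is well-formed if its variables are distinct. -/
def Ctx.WF {X : Type u} (Γ : Ctx X) : Prop := Γ.dom.Nodup

/-- List permutations of contexts, as data: `CtxPerm Γ Γ'` is the type of (presentations of)
permutations `π` with `Γ' = π(Γ)`. -/
inductive CtxPerm {X : Type u} : Ctx X → Ctx X → Type u
  | nil : CtxPerm [] []
  | cons (b : X × Ty) {Γ Γ' : Ctx X} : CtxPerm Γ Γ' → CtxPerm (b :: Γ) (b :: Γ')
  | swap (b c : X × Ty) (Γ : Ctx X) : CtxPerm (b :: c :: Γ) (c :: b :: Γ)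
  | trans {Γ Γ' Γ'' : Ctx X} : CtxPerm Γ Γ' → CtxPerm Γ' Γ'' → CtxPerm Γ Γ''

/-! ### The spanning, orthogonality and erasure judgments -/

/-- `Spanning T [e₁, …, eₙ]`. In the rule `pair`, the list `es` holds the pairs
`(e_j, [e'_{j,1}, …, e'_{j,n_j}])`. -/
inductive Spanning {X : Type u} : Ty → List (Exp X) → Prop
  | void : Spanning Ty.void []
  | unit : Spanning Ty.unit [Exp.unit]
  | var (T : Ty) (x : X) : Spanning T [Exp.var x]
  | sum {T T' : Ty} {es es' : List (Exp X)} : Spanning T es → Spanning T' es' →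
      Spanning (Ty.sum T T')
        (es.map (Exp.app (Prog.left T T')) ++ es'.map (Exp.app (Prog.right T T')))
  | pair {T T' : Ty} (es : List (Exp X × List (Exp X))) :
      Spanning T (es.map Prod.fst) →
      (∀ q ∈ es, Spanning T' q.2) →
      (∀ q ∈ es, ∀ e' ∈ q.2, Disjoint q.1.fv e'.fv) →
      Spanning (Ty.prod T T') (es.flatMap fun q => q.2.map (Exp.pair q.1))
  | perm {T : Ty} {es es' : List (Exp X)} : es.Perm es' → Spanning T es → Spanning T es'

/-- `Ortho T [e₁, …, eₙ]`: a subsequence of a spanning sequence. -/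
def Ortho {X : Type u} (T : Ty) (es : List (Exp X)) : Prop :=
  ∃ es' : List (Exp X), Spanning T es' ∧ es.Sublist es'

/-- `Erases x T [e₁, …, eₙ]`. The rule `ctrl` inlines the branches of a nested `ctrl`; as the `x`
of the judgment is a variable from outside that `ctrl`, its patterns do not bind `x`. -/
inductive Erases {X : Type u} (x : X) : Ty → List (Exp X) → Prop
  | var (T : Ty) (n : ℕ) : Erases x T (List.replicate n (Exp.var x))
  | gphase {T : Ty} (es es' : List (Exp X)) (e : Exp X) (y : X) (r : ℝ) :
      Erases x T (es ++ e :: es') →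
      Erases x T (es ++ Exp.app (Prog.gphase T y r) e :: es')
  | ctrl {T T' : Ty} {m : ℕ} (es es' : List (Exp X)) (e : Exp X) (p b : Fin m → Exp X) :
      (∀ i, x ∉ (p i).fv) →
      Erases x T (es ++ List.ofFn b ++ es') →
      Erases x T (es ++ Exp.ctrl e T' p b T :: es')
  | pair₀ {T₀ T₁ : Ty} (es : List (Exp X × Exp X)) :
      Erases x T₀ (es.map Prod.fst) →
      Erases x (Ty.prod T₀ T₁) (es.map fun q => Exp.pair q.1 q.2)
  | pair₁ {T₀ T₁ : Ty} (es : List (Exp X × Exp X)) :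
      Erases x T₁ (es.map Prod.snd) →
      Erases x (Ty.prod T₀ T₁) (es.map fun q => Exp.pair q.1 q.2)

/-! ### Typing

The types below are the types of typing derivations; a judgment is valid if its type of derivations
is inhabited. The well-formedness premises make all contexts in a derivation well-formed. -/

mutual
/-- Pure expression typing `Γ ∥ Δ ⊢ e : T`. -/
inductive PureExp {X : Type u} : Ctx X → Ctx X → Exp X → Ty → Type u
  | unit {Γ : Ctx X} (hΓ : Γ.WF) : PureExp Γ [] Exp.unit Ty.unit
  | cvar {Γ Γ' : Ctx X} {x : X} {T : Ty} (hΓ : Ctx.WF (Γ ++ (x, T) :: Γ')) :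
      PureExp (Γ ++ (x, T) :: Γ') [] (Exp.var x) T
  | qvar {Γ : Ctx X} {x : X} {T : Ty} (hΓ : Γ.WF) (hx : x ∉ Γ.dom) :
      PureExp Γ [(x, T)] (Exp.var x) T
  | pair {Γ Δ Δ₀ Δ₁ : Ctx X} {e₀ e₁ : Exp X} {T₀ T₁ : Ty}
      (hΔ : Ctx.WF (Δ ++ (Δ₀ ++ Δ₁)))
      (d₀ : PureExp Γ (Δ ++ Δ₀) e₀ T₀) (d₁ : PureExp Γ (Δ ++ Δ₁) e₁ T₁) :
      PureExp Γ (Δ ++ (Δ₀ ++ Δ₁)) (Exp.pair e₀ e₁) (Ty.prod T₀ T₁)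
  | ctrl {n : ℕ} {Γ Γ' Δ Δ' : Ctx X} {Γj : Fin n → Ctx X} {e : Exp X} {p b : Fin n → Exp X}
      {T T' : Ty}
      (hΓ : Ctx.WF (Γ ++ Γ')) (hΔ : Ctx.WF (Δ ++ Δ'))
      (d : MixedExp (Γ ++ Δ) e T)
      (ho : Ortho T (List.ofFn p))
      (dp : ∀ j, PureExp [] (Γj j) (p j) T)
      (he : ∀ x ∈ Δ.dom, Erases x T' (List.ofFn b))
      (db : ∀ j, PureExp ((Γ ++ Γ') ++ Γj j) (Δ ++ Δ') (b j) T') :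
      PureExp (Γ ++ Γ') (Δ ++ Δ') (Exp.ctrl e T p b T') T'
  | app {Γ Δ : Ctx X} {f : Prog X} {e : Exp X} {T T' : Ty}
      (df : PureProg f T T') (de : PureExp Γ Δ e T) : PureExp Γ Δ (Exp.app f e) T'
  | perm {Γ Γp Δ Δp : Ctx X} {e : Exp X} {T : Ty}
      (πg : CtxPerm Γ Γp) (πd : CtxPerm Δ Δp) (d : PureExp Γ Δ e T) : PureExp Γp Δp e T
/-- Mixed expression typing `Δ ⊩ e : T`. -/
inductive MixedExp {X : Type u} : Ctx X → Exp X → Ty → Type u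
  | mix {Δ : Ctx X} {e : Exp X} {T : Ty} (d : PureExp [] Δ e T) : MixedExp Δ e T
  | perm {Δ Δ' : Ctx X} {e : Exp X} {T : Ty} (π : CtxPerm Δ Δ') (d : MixedExp Δ e T) :
      MixedExp Δ' e T
  | pair {Δ Δ₀ Δ₁ : Ctx X} {e₀ e₁ : Exp X} {T₀ T₁ : Ty}
      (hΔ : Ctx.WF (Δ ++ (Δ₀ ++ Δ₁)))
      (d₀ : MixedExp (Δ ++ Δ₀) e₀ T₀) (d₁ : MixedExp (Δ ++ Δ₁) e₁ T₁) :
      MixedExp (Δ ++ (Δ₀ ++ Δ₁)) (Exp.pair e₀ e₁) (Ty.prod T₀ T₁)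
  | tryCatch {Δ₀ Δ₁ : Ctx X} {e₀ e₁ : Exp X} {T : Ty} (hΔ : Ctx.WF (Δ₀ ++ Δ₁))
      (d₀ : MixedExp Δ₀ e₀ T) (d₁ : MixedExp Δ₁ e₁ T) :
      MixedExp (Δ₀ ++ Δ₁) (Exp.tryCatch e₀ e₁) T
  | app {Δ : Ctx X} {f : Prog X} {e : Exp X} {T S : Ty}
      (df : MixedProg f T S) (de : MixedExp Δ e T) : MixedExp Δ (Exp.app f e) S
/-- Pure program typing `⊢ f : T ⇝ T'`. -/
inductive PureProg {X : Type u} : Prog X → Ty → Ty → Type u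
  | gate (rθ rφ rl : ℝ) : PureProg (Prog.u3 rθ rφ rl) Ty.bit Ty.bit
  | left (T₀ T₁ : Ty) : PureProg (Prog.left T₀ T₁) T₀ (Ty.sum T₀ T₁)
  | right (T₀ T₁ : Ty) : PureProg (Prog.right T₀ T₁) T₁ (Ty.sum T₀ T₁)
  | abs {Δ : Ctx X} {e e' : Exp X} {T T' : Ty}
      (d : PureExp [] Δ e T) (d' : PureExp [] Δ e' T') : PureProg (Prog.lam e T e') T T'
  | rphase {Δ : Ctx X} {e : Exp X} {T : Ty} (r s : ℝ) (d : PureExp [] Δ e T) :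
      PureProg (Prog.rphase T e r s) T T
/-- Mixed program typing `⊢ f : T ⇛ T'`. -/
inductive MixedProg {X : Type u} : Prog X → Ty → Ty → Type u
  | channel {f : Prog X} {T T' : Ty} (d : PureProg f T T') : MixedProg f T T'
  | abs {Δ Δ₀ : Ctx X} {e e' : Exp X} {T S : Ty}
      (d : PureExp [] (Δ ++ Δ₀) e T) (d' : MixedExp Δ e' S) : MixedProg (Prog.lam e T e') T S
end

/-! ### Values, valuations and Hilbert spaces

The Hilbert space of a type or context is represented through its canonical orthonormal basis: it is
`ℂ ^ Val`, and an operator `H(A) → H(B)` is a matrix with rows `B.Val` and columns `A.Val`. -/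

/-- The values `𝕍(T)`: `Sum.inl v`, `Sum.inr v` and `(v₀, v₁)` stand for `left v`, `right v`
and the pair. -/
@[reducible] def Ty.Val : Ty → Type
  | .void => Empty
  | .unit => Unit
  | .sum T₀ T₁ => T₀.Val ⊕ T₁.Val
  | .prod T₀ T₁ => T₀.Val × T₁.Val

instance Ty.Val.instFintype : (T : Ty) → Fintype T.Val
  | .void => inferInstanceAs (Fintype Empty)
  | .unit => inferInstanceAs (Fintype Unit)
  | .sum T₀ T₁ =>
      letI := Ty.Val.instFintype T₀
      letI := Ty.Val.instFintype T₁
      inferInstanceAs (Fintype (T₀.Val ⊕ T₁.Val))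
  | .prod T₀ T₁ =>
      letI := Ty.Val.instFintype T₀
      letI := Ty.Val.instFintype T₁
      inferInstanceAs (Fintype (T₀.Val × T₁.Val))

instance Ty.Val.instDecidableEq : (T : Ty) → DecidableEq T.Val
  | .void => inferInstanceAs (DecidableEq Empty)
  | .unit => inferInstanceAs (DecidableEq Unit)
  | .sum T₀ T₁ =>
      letI := Ty.Val.instDecidableEq T₀
      letI := Ty.Val.instDecidableEq T₁
      inferInstanceAs (DecidableEq (T₀.Val ⊕ T₁.Val))
  | .prod T₀ T₁ =>
      letI := Ty.Val.instDecidableEq T₀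
      letI := Ty.Val.instDecidableEq T₁
      inferInstanceAs (DecidableEq (T₀.Val × T₁.Val))

/-- The valuations `𝕍(x₁ : T₁, …, xₙ : Tₙ)`: a value for each binding, in order. -/
def Ctx.Val {X : Type u} : Ctx X → Type
  | [] => Unit
  | b :: Γ => b.2.Val × Ctx.Val Γ

instance Ctx.Val.instFintype {X : Type u} : (Γ : Ctx X) → Fintype (Ctx.Val Γ)
  | [] => inferInstanceAs (Fintype Unit)
  | b :: Γ =>
      letI := Ctx.Val.instFintype Γ
      inferInstanceAs (Fintype (b.2.Val × Ctx.Val Γ))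

instance Ctx.Val.instDecidableEq {X : Type u} : (Γ : Ctx X) → DecidableEq (Ctx.Val Γ)
  | [] => inferInstanceAs (DecidableEq Unit)
  | b :: Γ =>
      letI := Ctx.Val.instDecidableEq Γ
      inferInstanceAs (DecidableEq (b.2.Val × Ctx.Val Γ))

/-- The empty valuation. -/
def Ctx.Val.nil {X : Type u} : Ctx.Val ([] : Ctx X) := ()

/-- Concatenation of valuations, as a bijection `𝕍(Γ) × 𝕍(Δ) ≃ 𝕍(Γ, Δ)`. -/
def Ctx.Val.append {X : Type u} : (Γ Δ : Ctx X) → Ctx.Val Γ × Ctx.Val Δ ≃ Ctx.Val (Γ ++ Δ)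
  | [], Δ => Equiv.punitProd (Ctx.Val Δ)
  | b :: Γ, Δ =>
      (Equiv.prodAssoc b.2.Val (Ctx.Val Γ) (Ctx.Val Δ)).trans
        (Equiv.prodCongr (Equiv.refl b.2.Val) (Ctx.Val.append Γ Δ))

/-- The part of a valuation of `Γ, Δ` on `Γ`. -/
def Ctx.Val.fst {X : Type u} {Γ Δ : Ctx X} (τ : Ctx.Val (Γ ++ Δ)) : Ctx.Val Γ :=
  ((Ctx.Val.append Γ Δ).symm τ).1

/-- The part of a valuation of `Γ, Δ` on `Δ`. -/
def Ctx.Val.snd {X : Type u} {Γ Δ : Ctx X} (τ : Ctx.Val (Γ ++ Δ)) : Ctx.Val Δ :=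
  ((Ctx.Val.append Γ Δ).symm τ).2

/-- Concatenation `σ, τ` of valuations. -/
def Ctx.Val.cat {X : Type u} {Γ Δ : Ctx X} (σ : Ctx.Val Γ) (τ : Ctx.Val Δ) : Ctx.Val (Γ ++ Δ) :=
  Ctx.Val.append Γ Δ (σ, τ)

/-- The value of the first binding of a valuation. -/
def Ctx.Val.head {X : Type u} {x : X} {T : Ty} {Γ : Ctx X} (τ : Ctx.Val ((x, T) :: Γ)) : T.Val :=
  Prod.fst τ

/-- The action `τ ↦ π(τ)` of a permutation on valuations. -/
def CtxPerm.val {X : Type u} : {Γ Γ' : Ctx X} → CtxPerm Γ Γ' → Ctx.Val Γ ≃ Ctx.Val Γ'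
  | _, _, .nil => Equiv.refl _
  | _, _, .cons b π => Equiv.prodCongr (Equiv.refl b.2.Val) π.val
  | _, _, .swap b c Γ =>
      { toFun := fun τ => (τ.2.1, τ.1, τ.2.2)
        invFun := fun τ => (τ.2.1, τ.1, τ.2.2)
        left_inv := fun _ => rfl
        right_inv := fun _ => rfl }
  | _, _, .trans π π' => π.val.trans π'.val

/-! ### Operators and superoperators -/

/-- Linear operators, as matrices in the canonical bases. -/
abbrev Op (m n : Type) : Type := Matrix n m ℂ

/-- Superoperators: linear maps from operators on `ℂ ^ m` to operators on `ℂ ^ n`. -/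
abbrev SuperOp (m n : Type) : Type := Matrix m m ℂ →ₗ[ℂ] Matrix n n ℂ

/-- The operator with `|a⟩ ↦ |f a⟩`. -/
def basisOp {m n : Type} [DecidableEq n] (f : m → n) : Op m n :=
  Matrix.of fun b a => if b = f a then 1 else 0

/-- The operator `|a⟩⟨b|`. -/
def ketbra {m : Type} [DecidableEq m] (a b : m) : Matrix m m ℂ := Matrix.single a b 1

/-- The superoperator with `|a⟩⟨b| ↦ g a b`, extended by linearity. -/
def superOp {m n : Type} [Fintype m] (g : m → m → Matrix n n ℂ) : SuperOp m n where
  toFun ρ := ∑ a, ∑ b, ρ a b • g a b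
  map_add' ρ ρ' := by simp [add_smul, Finset.sum_add_distrib]
  map_smul' c ρ := by simp [mul_smul, Finset.smul_sum]

theorem superOp_ketbra {m n : Type} [Fintype m] [DecidableEq m] (g : m → m → Matrix n n ℂ)
    (a b : m) : superOp g (ketbra a b) = g a b := by
  simp only [superOp, ketbra, LinearMap.coe_mk, AddHom.coe_mk]
  rw [Finset.sum_eq_single a, Finset.sum_eq_single b]
  · simp
  · intro c _ hc
    simp [hc.symm]
  · simp
  · intro c _ hc
    simp [hc.symm]
  · simp

/-- The partial trace over `Δ₀` of an operator on `H(Δ, Δ₀)`. -/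
def ptrace {X : Type u} (Δ Δ₀ : Ctx X) (M : Matrix (Ctx.Val (Δ ++ Δ₀)) (Ctx.Val (Δ ++ Δ₀)) ℂ) :
    Matrix (Ctx.Val Δ) (Ctx.Val Δ) ℂ :=
  Matrix.of fun τ τ' => ∑ τ₀ : Ctx.Val Δ₀, M (τ.cat τ₀) (τ'.cat τ₀)

/-- The matrix of the gate `u3`; `Sum.inl ()` is the value `0` and `Sum.inr ()` the value `1`. -/
def u3Matrix (rθ rφ rl : ℝ) : Op Ty.bit.Val Ty.bit.Val :=
  Matrix.of fun b a => match a, b with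
    | Sum.inl _, Sum.inl _ => (Real.cos (rθ / 2) : ℂ)
    | Sum.inl _, Sum.inr _ => Complex.exp (Complex.I * rφ) * (Real.sin (rθ / 2) : ℂ)
    | Sum.inr _, Sum.inl _ => - (Complex.exp (Complex.I * rl) * (Real.sin (rθ / 2) : ℂ))
    | Sum.inr _, Sum.inr _ => Complex.exp (Complex.I * (rφ + rl)) * (Real.cos (rθ / 2) : ℂ)

/-! ### Denotational semantics, by recursion on the typing derivation -/

mutual
/-- The pure semantics `⟦σ : Γ ∥ Δ ⊢ e : T⟧` of an expression. -/
def PureExp.sem {X : Type u} : {Γ Δ : Ctx X} → {e : Exp X} → {T : Ty} → PureExp Γ Δ e T →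
    Ctx.Val Γ → Op (Ctx.Val Δ) T.Val
  | _, _, _, _, .unit _, _ => basisOp fun _ => ()
  | _, _, _, _, .cvar _, σ => basisOp fun _ => σ.snd.head
  | _, _, _, _, .qvar _ _, _ => basisOp fun τ => τ.head
  | _, _, _, _, .pair _ d₀ d₁, σ =>
      Matrix.of fun v τ =>
        d₀.sem σ v.1 (τ.fst.cat τ.snd.fst) * d₁.sem σ v.2 (τ.fst.cat τ.snd.snd)
  | _, _, _, _, .ctrl (Γj := Γj) (T := T) _ _ d _ dp _ db, σ =>
      Matrix.of fun v' τ =>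
        ∑ v : T.Val, d.sem (ketbra (σ.fst.cat τ.fst) (σ.fst.cat τ.fst)) v v *
          ∑ j, ∑ σj : Ctx.Val (Γj j),
            ((dp j).sem Ctx.Val.nil)ᴴ σj v * (db j).sem (σ.cat σj) v' τ
  | _, _, _, _, .app df de, σ => df.sem * de.sem σ
  | _, _, _, _, .perm πg πd d, σ =>
      Matrix.of fun v τ => d.sem (πg.val.symm σ) v (πd.val.symm τ)
/-- The mixed semantics `⟦Δ ⊩ e : T⟧` of an expression. In the case of `tryCatch`, the traces of
the basis operators `|τ⟩⟨τ'|` are what makes the formula linear; they are `1` for `τ = τ'`. -/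
def MixedExp.sem {X : Type u} : {Δ : Ctx X} → {e : Exp X} → {T : Ty} → MixedExp Δ e T →
    SuperOp (Ctx.Val Δ) T.Val
  | _, _, _, .mix d => superOp fun τ τ' =>
      d.sem Ctx.Val.nil * ketbra τ τ' * (d.sem Ctx.Val.nil)ᴴ
  | _, _, _, .perm π d => superOp fun τ τ' => d.sem (ketbra (π.val.symm τ) (π.val.symm τ'))
  | _, _, _, .pair _ d₀ d₁ => superOp fun τ τ' =>
      d₀.sem (ketbra (τ.fst.cat τ.snd.fst) (τ'.fst.cat τ'.snd.fst)) ⊗ₖ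
        d₁.sem (ketbra (τ.fst.cat τ.snd.snd) (τ'.fst.cat τ'.snd.snd))
  | _, _, _, .tryCatch _ d₀ d₁ => superOp fun τ τ' =>
      (ketbra τ.snd τ'.snd).trace • d₀.sem (ketbra τ.fst τ'.fst) +
        ((ketbra τ.fst τ'.fst).trace - (d₀.sem (ketbra τ.fst τ'.fst)).trace) •
          d₁.sem (ketbra τ.snd τ'.snd)
  | _, _, _, .app df de => df.sem ∘ₗ de.sem
/-- The pure semantics `⟦⊢ f : T ⇝ T'⟧` of a program. -/
def PureProg.sem {X : Type u} : {f : Prog X} → {T T' : Ty} → PureProg f T T' → Op T.Val T'.Val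
  | _, _, _, .gate rθ rφ rl => u3Matrix rθ rφ rl
  | _, _, _, .left _ _ => basisOp Sum.inl
  | _, _, _, .right _ _ => basisOp Sum.inr
  | _, _, _, .abs d d' => d'.sem Ctx.Val.nil * (d.sem Ctx.Val.nil)ᴴ
  | _, _, _, .rphase r r' d =>
      Complex.exp (Complex.I * r) • (d.sem Ctx.Val.nil * (d.sem Ctx.Val.nil)ᴴ) +
        Complex.exp (Complex.I * r') • (1 - d.sem Ctx.Val.nil * (d.sem Ctx.Val.nil)ᴴ)
/-- The mixed semantics `⟦⊢ f : T ⇛ T'⟧` of a program. -/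
def MixedProg.sem {X : Type u} : {f : Prog X} → {T T' : Ty} → MixedProg f T T' →
    SuperOp T.Val T'.Val
  | _, _, _, .channel d => superOp fun v v' => d.sem * ketbra v v' * d.semᴴ
  | _, _, _, .abs (Δ := Δ) (Δ₀ := Δ₀) d d' => superOp fun v v' =>
      d'.sem (ptrace Δ Δ₀ ((d.sem Ctx.Val.nil)ᴴ * ketbra v v' * d.sem Ctx.Val.nil))
end

/-! ### Kraus operators and completely positive, trace-non-increasing superoperators -/

/-- `E` is a Kraus operator: `E† E ⊑ I` in the Löwner order. -/
def IsKraus {m n : Type} [Fintype m] [DecidableEq m] [Fintype n] (E : Op m n) : Prop :=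
  (1 - Eᴴ * E).PosSemidef

/-- The ampliation `id_k ⊗ Φ`, which applies `Φ` to each block of a `k × k` block matrix. -/
def ampliation {m n : Type} (Φ : SuperOp m n) (k : ℕ) (M : Matrix (Fin k × m) (Fin k × m) ℂ) :
    Matrix (Fin k × n) (Fin k × n) ℂ :=
  Matrix.of fun a b => Φ (Matrix.of fun i j => M (a.1, i) (b.1, j)) a.2 b.2

/-- `Φ` is completely positive: all its ampliations preserve positive semidefiniteness. -/
def IsCompletelyPositive {m n : Type} (Φ : SuperOp m n) : Prop :=
  ∀ (k : ℕ) (M : Matrix (Fin k × m) (Fin k × m) ℂ), M.PosSemidef → (ampliation Φ k M).PosSemidef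

/-- `Φ` does not increase the trace of positive semidefinite operators. -/
def IsTraceNonIncreasing {m n : Type} [Fintype m] [Fintype n] (Φ : SuperOp m n) : Prop :=
  ∀ ρ : Matrix m m ℂ, ρ.PosSemidef → (Φ ρ).trace ≤ ρ.trace

end Qunity

end

/-!
The proof is by induction on typing derivations. For pure judgments the invariant is the one
claimed; for mixed judgments it is `HasKraus`, the existence of a Kraus decomposition
`ρ ↦ ∑ i, K i ρ (K i)†` with `∑ i, (K i)† (K i) ⊑ 1`, which gives both complete positivity and trace
non-increase.

Most rules are assembled from operations that preserve these invariants. Kraus operators are the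
contractions (`isKraus_iff_norm_le_one`), hence closed under products, adjoints, tensor products and
subconvex combinations, and injections of bases are isometries. Sharing the context between the
components of a pair is such an injection (`share`). For `rphase`, the operator `a P + b (1 - P)`
with phases `a`, `b` and `0 ⊑ P ⊑ 1` is a contraction even though `P = E E†` need not be a
projection (`IsKraus.phase_combination`). For `try`, the failure probability `tr ρ - tr (Φ ρ)` is
`tr (B† B ρ)`, where `B† B = 1 - ∑ i, (K i)† (K i)` (`HasKraus.tryOp`).

The rule `ctrl` needs the judgments on patterns and branches, through two facts.

* Orthogonality: a pattern denotes an injection of valuations into the values that match it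
  (`PureExp.sem_eq_basisOp_of_isPattern`), and no value matches two patterns of a spanning list
  (`Spanning.pairwise_not_matches`). So each outcome of the scrutinee selects at most one branch,
  and for fixed values of the quantum variables in the scrutinee the operator is a subconvex
  combination of Kraus operators.
* Erasure: if the branches erase `x`, then one function recovers the value of `x` from the outcome
  of any branch (`Erases.exists_exposes`). So for different values of these quantum variables
  the outcomes are different, and the operator is a Kraus operator because its blocks of columns
  have disjoint supports (`isKraus_of_blocks`).

Erasure yields this only if `x` is not in the classical context of the branch. The patterns of a
nested `ctrl` do not bind `x` by the rules of erasure; apart from that, a variable can be in both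
contexts of a derivation only if the denotation vanishes (`PureExp.sem_eq_zero_of_mem_dom`).
-/

namespace Qunity

/-! ### Kraus operators -/

section Kraus

variable {l m n : Type} [Fintype l] [DecidableEq l] [Fintype m] [DecidableEq m] [Fintype n]

open scoped Matrix.Norms.L2Operator MatrixOrder in
/-- By the C⋆-identity, `E` is a Kraus operator iff its operator norm is at most `1`. -/
theorem isKraus_iff_norm_le_one {E : Op m n} : IsKraus E ↔ ‖E‖ ≤ 1 := by
  have h := CStarAlgebra.norm_le_one_iff_of_nonneg (Eᴴ * E)
    (Matrix.nonneg_iff_posSemidef.2 (Matrix.posSemidef_conjTranspose_mul_self E))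
  rw [Matrix.le_iff, Matrix.l2_opNorm_conjTranspose_mul_self] at h
  rw [IsKraus, ← h]
  constructor <;> intro h' <;> nlinarith [norm_nonneg E]

open scoped Matrix.Norms.L2Operator in
theorem IsKraus.conjTranspose [DecidableEq n] {E : Op m n} (hE : IsKraus E) : IsKraus Eᴴ := by
  rw [isKraus_iff_norm_le_one] at *
  rwa [Matrix.l2_opNorm_conjTranspose]

theorem IsKraus.mul {E : Op m n} {F : Op l m} (hE : IsKraus E) (hF : IsKraus F) :
    IsKraus (E * F) := by
  have h := (hE.conjTranspose_mul_mul_same F).add hF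
  rw [IsKraus]
  convert h using 1
  simp only [Matrix.conjTranspose_mul, Matrix.mul_sub, Matrix.sub_mul, Matrix.mul_assoc,
    Matrix.mul_one]
  abel

theorem isKraus_zero : IsKraus (0 : Op m n) := by
  simpa [IsKraus] using Matrix.PosSemidef.one

theorem isKraus_of_isometry {E : Op m n} (h : Eᴴ * E = 1) : IsKraus E := by
  simpa [IsKraus, h] using Matrix.PosSemidef.zero

theorem isKraus_basisOp [DecidableEq n] {f : m → n} (hf : f.Injective) :
    IsKraus (basisOp f) := by
  refine isKraus_of_isometry ?_
  ext a b
  simp [basisOp, Matrix.mul_apply, Matrix.one_apply, hf.eq_iff, eq_comm]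

theorem mul_basisOp_apply {l m n : Type} [Fintype m] [DecidableEq m] (E : Op m n) (f : l → m)
    (v : n) (a : l) : (E * basisOp f) v a = E v (f a) := by
  simp [Matrix.mul_apply, basisOp]

theorem basisOp_mul_basisOp {l m n : Type} [Fintype m] [DecidableEq m] [DecidableEq n]
    (g : m → n) (f : l → m) : basisOp g * basisOp f = basisOp (g ∘ f) := by
  ext v a
  simp [basisOp, Matrix.mul_apply]

open scoped Matrix.Norms.L2Operator in
/-- The Kraus operators are the unit ball of the operator norm, hence closed under subconvex
combinations. -/
theorem isKraus_sum_smul {ι : Type*} [Fintype ι] {c : ι → ℂ} {E : ι → Op m n}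
    (hc : ∀ i, 0 ≤ c i) (hc' : ∑ i, c i ≤ 1) (hE : ∀ i, IsKraus (E i)) :
    IsKraus (∑ i, c i • E i) := by
  simp only [isKraus_iff_norm_le_one] at *
  refine (norm_sum_le _ _).trans ?_
  have h : ∑ i, ‖c i‖ ≤ 1 := by
    have h1 : ((∑ i, ‖c i‖ : ℝ) : ℂ) = ∑ i, c i := by
      push_cast
      exact Finset.sum_congr rfl fun i _ => (Complex.eq_coe_norm_of_nonneg (hc i)).symm
    rw [← h1] at hc'
    exact_mod_cast hc'
  refine (Finset.sum_le_sum fun i _ => ?_).trans h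
  rw [norm_smul]
  exact mul_le_of_le_one_right (norm_nonneg _) (hE i)

theorem posSemidef_one_sub_kronecker {m' : Type} [Fintype m'] [DecidableEq m']
    {A : Matrix m m ℂ} {B : Matrix m' m' ℂ} (hA : A.PosSemidef)
    (hA' : (1 - A).PosSemidef) (hB' : (1 - B).PosSemidef) : (1 - A ⊗ₖ B).PosSemidef := by
  have h := (hA'.kronecker (Matrix.PosSemidef.one (n := m'))).add (hA.kronecker hB')
  have h₁ : (1 : Matrix (m × m') (m × m') ℂ) = (1 - A) ⊗ₖ 1 + A ⊗ₖ 1 := by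
    rw [← Matrix.add_kronecker, sub_add_cancel, Matrix.one_kronecker_one]
  have h₂ : A ⊗ₖ (1 : Matrix m' m' ℂ) = A ⊗ₖ (1 - B) + A ⊗ₖ B := by
    rw [← Matrix.kronecker_add, sub_add_cancel]
  have h₃ : 1 - A ⊗ₖ B = (1 - A) ⊗ₖ 1 + A ⊗ₖ (1 - B) := by
    rw [h₁, h₂]
    abel
  rw [h₃]
  exact h

theorem IsKraus.kronecker {m' n' : Type} [Fintype m'] [DecidableEq m'] [Fintype n']
    {E : Op m n} {F : Op m' n'} (hE : IsKraus E) (hF : IsKraus F) : IsKraus (E ⊗ₖ F) := by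
  rw [IsKraus, Matrix.conjTranspose_kronecker, ← Matrix.mul_kronecker_mul]
  exact posSemidef_one_sub_kronecker (Matrix.posSemidef_conjTranspose_mul_self E) hE hF

theorem star_exp_I_mul_self (t : ℝ) :
    star (Complex.exp (Complex.I * t)) * Complex.exp (Complex.I * t) = 1 := by
  simp [Complex.conj_mul', mul_comm Complex.I, Complex.norm_exp_ofReal_mul_I]

/-- With `P = E E†`, the operator `U = a P + b (1 - P)` for phases `a`, `b` satisfies
`1 - U† U = |a - b|² P (1 - P)`, and `P (1 - P) = E (1 - E† E) E†` is positive. -/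
theorem IsKraus.phase_combination [DecidableEq n] {E : Op m n} (hE : IsKraus E) (r s : ℝ) :
    IsKraus (Complex.exp (Complex.I * r) • (E * Eᴴ) +
      Complex.exp (Complex.I * s) • (1 - E * Eᴴ)) := by
  have ha := star_exp_I_mul_self r
  have hb := star_exp_I_mul_self s
  generalize Complex.exp (Complex.I * r) = a at *
  generalize Complex.exp (Complex.I * s) = b at *
  have hQ : (E * Eᴴ - E * Eᴴ * (E * Eᴴ)).PosSemidef := by
    have h := hE.mul_mul_conjTranspose_same E
    rwa [Matrix.mul_sub, Matrix.sub_mul, Matrix.mul_one, Matrix.mul_assoc, Matrix.mul_assoc,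
      ← Matrix.mul_assoc] at h
  have hP : (E * Eᴴ)ᴴ = E * Eᴴ := by simp
  generalize E * Eᴴ = P at *
  have h : 1 - (a • P + b • (1 - P))ᴴ * (a • P + b • (1 - P)) =
      (star (a - b) * (a - b)) • (P - P * P) := by
    have h₁ : (a • P + b • (1 - P))ᴴ * (a • P + b • (1 - P)) =
        (star a * a) • (P * P) + (star a * b + star b * a) • (P - P * P) +
          (star b * b) • (1 - (2 : ℂ) • P + P * P) := by
      simp only [Matrix.conjTranspose_add, Matrix.conjTranspose_smul, Matrix.conjTranspose_sub,
        hP, Matrix.conjTranspose_one, add_mul, mul_add, smul_mul_smul_comm, sub_mul, mul_sub,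
        one_mul, mul_one]
      module
    have h₂ : star (a - b) * (a - b) = 2 - (star a * b + star b * a) := by
      rw [star_sub]
      linear_combination ha + hb
    rw [h₁, h₂, ha, hb]
    module
  rw [IsKraus, h]
  exact hQ.smul (star_mul_self_nonneg _)

theorem isKraus_u3Matrix (rθ rφ rl : ℝ) : IsKraus (u3Matrix rθ rφ rl) := by
  have ha := star_exp_I_mul_self rφ
  have hb := star_exp_I_mul_self rl
  have hcs : (Real.cos (rθ / 2) : ℂ) ^ 2 + (Real.sin (rθ / 2) : ℂ) ^ 2 = 1 := by
    exact_mod_cast Real.cos_sq_add_sin_sq (rθ / 2)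
  refine isKraus_of_isometry ?_
  ext a b
  rcases a with a | a <;> rcases b with b | b <;>
    simp only [u3Matrix, Matrix.mul_apply, mul_add, Complex.exp_add, Matrix.conjTranspose_apply,
      Matrix.of_apply, Fintype.sum_sum_type, Complex.star_def, map_mul,
      map_neg, Complex.conj_ofReal, Matrix.one_apply, Finset.univ_unique,
      Finset.sum_singleton] at * <;>
    generalize Complex.exp (Complex.I * rφ) = x at * <;>
    generalize Complex.exp (Complex.I * rl) = y at *
  · rw [if_pos trivial]
    linear_combination hcs + (Real.sin (rθ / 2) : ℂ) ^ 2 * ha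
  · rw [if_neg (by simp)]
    linear_combination (Real.sin (rθ / 2) : ℂ) * Real.cos (rθ / 2) * y * ha
  · rw [if_neg (by simp)]
    linear_combination (Real.sin (rθ / 2) : ℂ) * Real.cos (rθ / 2) * (starRingEnd ℂ y) * ha
  · rw [if_pos trivial]
    linear_combination hcs + (Real.sin (rθ / 2) : ℂ) ^ 2 * hb +
      (Real.cos (rθ / 2) : ℂ) ^ 2 * ((starRingEnd ℂ y) * y * ha + hb)

/-- A matrix whose columns fall into blocks, such that each block is part of a Kraus operator and
columns of different blocks have disjoint supports, is a Kraus operator. -/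
theorem isKraus_of_blocks {k : Type} [Fintype k] [DecidableEq k] {A : Op m n} (q : m → k)
    (B : k → Op m n) (hB : ∀ t, IsKraus (B t)) (hA : ∀ v a, A v a = B (q a) v a)
    (hq : ∀ v a a', A v a ≠ 0 → A v a' ≠ 0 → q a = q a') : IsKraus A := by
  have h : 1 - Aᴴ * A = ∑ t, (Matrix.diagonal fun a => if q a = t then (1 : ℂ) else 0)ᴴ *
      (1 - (B t)ᴴ * B t) * (Matrix.diagonal fun a => if q a = t then (1 : ℂ) else 0) := by
    ext a a'
    simp only [Matrix.sum_apply, Matrix.diagonal_conjTranspose, Matrix.mul_diagonal,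
      Matrix.diagonal_mul, Matrix.sub_apply, Pi.star_apply]
    rw [Finset.sum_eq_single (q a) (fun t _ ht => by simp [ht.symm]) (by simp)]
    by_cases haa : q a' = q a
    · simp [haa, Matrix.mul_apply, hA]
    · have h1 : a ≠ a' := fun h => haa (by rw [h])
      simp only [haa, Matrix.one_apply_ne h1, Matrix.mul_apply]
      simp only [if_false, mul_zero, zero_sub, neg_eq_zero]
      refine Finset.sum_eq_zero fun v _ => ?_
      by_contra hv
      obtain ⟨hv1, hv2⟩ := mul_ne_zero_iff.1 hv
      exact haa (hq v a' a hv2 (by simpa using hv1))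
  rw [IsKraus, h]
  exact Matrix.posSemidef_sum _ fun t _ => (hB t).conjTranspose_mul_mul_same _

end Kraus

/-! ### Kraus decompositions of superoperators -/

section Decomposition

variable {l m n k m' n' : Type} [Fintype m]

/-- The superoperator `ρ ↦ E ρ E†`. -/
def conjBy (E : Op m n) : SuperOp m n where
  toFun ρ := E * ρ * Eᴴ
  map_add' ρ ρ' := by simp [Matrix.mul_add, Matrix.add_mul]
  map_smul' c ρ := by simp

theorem conjBy_apply (E : Op m n) (ρ : Matrix m m ℂ) : conjBy E ρ = E * ρ * Eᴴ := rfl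

theorem trace_sum_conjBy [Fintype n] {ι : Type} [Fintype ι] (K : ι → Op m n) (ρ : Matrix m m ℂ) :
    ((∑ i, conjBy (K i)) ρ).trace = ((∑ i, (K i)ᴴ * K i) * ρ).trace := by
  simp only [LinearMap.sum_apply, Matrix.trace_sum, conjBy_apply, Matrix.sum_mul]
  exact Finset.sum_congr rfl fun i _ => by rw [Matrix.trace_mul_comm, ← Matrix.mul_assoc]

variable [DecidableEq m]

theorem conjBy_ketbra_apply (E : Op m n) (a b : m) (v w : n) :
    conjBy E (ketbra a b) v w = E v a * star (E w b) := by
  simp [conjBy, ketbra, Matrix.mul_apply, Matrix.single_apply, ite_and, Finset.sum_ite_eq]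

theorem conjBy_basisOp_ketbra [DecidableEq n] (f : m → n) (a b : m) :
    conjBy (basisOp f) (ketbra a b) = ketbra (f a) (f b) := by
  ext v w
  rw [conjBy_ketbra_apply]
  simp only [basisOp, ketbra, Matrix.of_apply, Matrix.single_apply]
  split_ifs <;> simp_all

theorem superOp_eq_iff {g : m → m → Matrix n n ℂ} {Φ : SuperOp m n} :
    superOp g = Φ ↔ ∀ a b, g a b = Φ (ketbra a b) := by
  refine ⟨fun h a b => by rw [← h, superOp_ketbra], fun h => ?_⟩
  refine Matrix.ext_linearMap ℂ fun a b => LinearMap.ext_ring ?_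
  exact (superOp_ketbra g a b).trans (h a b)

theorem superOp_mul_ketbra_mul (E : Op m n) :
    (superOp fun a b => (E * ketbra a b * Eᴴ : Matrix n n ℂ)) = conjBy E :=
  superOp_eq_iff.2 fun _ _ => rfl

variable [Fintype n]

/-- `Φ` has a Kraus decomposition `ρ ↦ ∑ i, K i ρ (K i)†` with `∑ i, (K i)† (K i) ⊑ 1`. This is the
invariant of the induction over mixed derivations: it implies complete positivity and that the trace
does not increase, and unlike these it passes to tensor products by a direct computation. -/
def HasKraus (Φ : SuperOp m n) : Prop :=
  ∃ (ι : Type) (_ : Fintype ι) (K : ι → Op m n),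
    Φ = ∑ i, conjBy (K i) ∧ (1 - ∑ i, (K i)ᴴ * K i).PosSemidef

theorem HasKraus.isCompletelyPositive {Φ : SuperOp m n} (h : HasKraus Φ) :
    IsCompletelyPositive Φ := by
  obtain ⟨ι, _, K, rfl, -⟩ := h
  intro k M hM
  have h : ampliation (∑ i, conjBy (K i)) k M =
      ∑ i, ((1 : Matrix (Fin k) (Fin k) ℂ) ⊗ₖ K i) * M *
        ((1 : Matrix (Fin k) (Fin k) ℂ) ⊗ₖ K i)ᴴ := by
    ext a b
    rw [Matrix.sum_apply]
    simp [ampliation, conjBy, Matrix.sum_apply, Matrix.mul_apply, Fintype.sum_prod_type,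
      Matrix.one_apply, ite_mul, Finset.sum_ite_eq, apply_ite]
  rw [h]
  exact Matrix.posSemidef_sum _ fun i _ => hM.mul_mul_conjTranspose_same _

open scoped Matrix.Norms.L2Operator MatrixOrder in
theorem exists_eq_conjTranspose_mul_self {A : Matrix m m ℂ} (hA : A.PosSemidef) :
    ∃ B : Matrix m m ℂ, A = Bᴴ * B :=
  CStarAlgebra.nonneg_iff_eq_star_mul_self.1 (Matrix.nonneg_iff_posSemidef.2 hA)

theorem HasKraus.isTraceNonIncreasing {Φ : SuperOp m n} (h : HasKraus Φ) :
    IsTraceNonIncreasing Φ := by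
  obtain ⟨ι, _, K, rfl, hK⟩ := h
  intro ρ hρ
  obtain ⟨B, hB⟩ := exists_eq_conjTranspose_mul_self hK
  have h : ρ.trace - ((∑ i, conjBy (K i)) ρ).trace = (B * ρ * Bᴴ).trace := by
    rw [trace_sum_conjBy, ← Matrix.trace_sub, Matrix.trace_mul_comm, ← Matrix.mul_assoc, ← hB,
      Matrix.sub_mul, Matrix.one_mul]
  rw [← sub_nonneg, h]
  exact (hρ.mul_mul_conjTranspose_same B).trace_nonneg

theorem posSemidef_ketbra {m : Type} [DecidableEq m] (a : m) :
    (ketbra a a).PosSemidef := by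
  have h : ketbra a a = Matrix.diagonal (Pi.single a (1 : ℂ)) := by
    rw [Matrix.diagonal_single]
    rfl
  rw [h]
  exact Matrix.PosSemidef.diagonal (Pi.single_nonneg.2 zero_le_one)

/-- The diagonal entries of `Φ |a⟩⟨a|`, the probabilities of the outcomes of `Φ` on `|a⟩`, form a
subprobability distribution. -/
theorem HasKraus.diag_nonneg_and_sum_le_one {Φ : SuperOp m n} (h : HasKraus Φ) (a : m) :
    (∀ v, 0 ≤ Φ (ketbra a a) v v) ∧ ∑ v, Φ (ketbra a a) v v ≤ 1 := by
  constructor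
  · obtain ⟨ι, _, K, rfl, -⟩ := h
    intro v
    rw [LinearMap.sum_apply, Matrix.sum_apply]
    refine Finset.sum_nonneg fun i _ => ?_
    rw [conjBy_ketbra_apply]
    exact mul_star_self_nonneg _
  · refine (h.isTraceNonIncreasing _ (posSemidef_ketbra a)).trans_eq ?_
    simp [ketbra]

theorem IsKraus.hasKraus_conjBy {E : Op m n} (hE : IsKraus E) : HasKraus (conjBy E) :=
  ⟨Unit, inferInstance, fun _ => E, by simp, by simpa [IsKraus] using hE⟩

variable [Fintype l] [DecidableEq l] [Fintype k] [DecidableEq k] [Fintype m'] [DecidableEq m']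
  [Fintype n']

theorem HasKraus.comp {Φ : SuperOp m n} {Ψ : SuperOp l m} (hΦ : HasKraus Φ) (hΨ : HasKraus Ψ) :
    HasKraus (Φ ∘ₗ Ψ) := by
  obtain ⟨ι, _, K, rfl, hK⟩ := hΦ
  obtain ⟨κ, _, L, rfl, hL⟩ := hΨ
  refine ⟨κ × ι, inferInstance, fun i => K i.2 * L i.1, ?_, ?_⟩
  · ext1 ρ
    simp only [LinearMap.comp_apply, LinearMap.sum_apply, map_sum, Fintype.sum_prod_type,
      conjBy_apply, Matrix.conjTranspose_mul, Matrix.mul_assoc]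
  · have h := (Matrix.posSemidef_sum Finset.univ fun j _ =>
      hK.conjTranspose_mul_mul_same (L j)).add hL
    convert h using 1
    simp only [Fintype.sum_prod_type, Matrix.conjTranspose_mul, Matrix.mul_sub, Matrix.sub_mul,
      Matrix.mul_one, Finset.sum_sub_distrib, Matrix.mul_sum, Matrix.sum_mul, Matrix.mul_assoc]
    abel

/-- The tensor product of two superoperators. -/
noncomputable def tensorOp (Φ : SuperOp m n) (Ψ : SuperOp m' n') : SuperOp (m × m') (n × n') :=
  superOp fun a b => Φ (ketbra a.1 b.1) ⊗ₖ Ψ (ketbra a.2 b.2)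

theorem HasKraus.tensorOp {Φ : SuperOp m n} {Ψ : SuperOp m' n'} (hΦ : HasKraus Φ)
    (hΨ : HasKraus Ψ) : HasKraus (tensorOp Φ Ψ) := by
  obtain ⟨ι, _, K, rfl, hK⟩ := hΦ
  obtain ⟨κ, _, L, rfl, hL⟩ := hΨ
  refine ⟨ι × κ, inferInstance, fun i => K i.1 ⊗ₖ L i.2, ?_, ?_⟩
  · refine superOp_eq_iff.2 fun a b => ?_
    ext v w
    simp only [Matrix.kroneckerMap_apply, LinearMap.sum_apply, Matrix.sum_apply,
      conjBy_ketbra_apply, Fintype.sum_prod_type, Finset.sum_mul_sum, star_mul']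
    exact Finset.sum_congr rfl fun i _ => Finset.sum_congr rfl fun j _ => by ring
  · have h : ∑ i : ι × κ, (K i.1 ⊗ₖ L i.2)ᴴ * (K i.1 ⊗ₖ L i.2) =
        (∑ i, (K i)ᴴ * K i) ⊗ₖ (∑ j, (L j)ᴴ * L j) := by
      ext a b
      simp [Matrix.conjTranspose_kronecker, ← Matrix.mul_kronecker_mul, Matrix.sum_apply,
        Fintype.sum_prod_type, Finset.sum_mul_sum]
    rw [h]
    exact posSemidef_one_sub_kronecker
      (Matrix.posSemidef_sum _ fun i _ => Matrix.posSemidef_conjTranspose_mul_self _) hK hL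

/-- The partial trace over the second factor. -/
noncomputable def traceRight (m k : Type) [Fintype k] : SuperOp (m × k) m where
  toFun ρ := Matrix.of fun a b => ∑ c, ρ (a, c) (b, c)
  map_add' ρ ρ' := by ext; simp [Finset.sum_add_distrib]
  map_smul' c ρ := by ext; simp [Finset.mul_sum]

theorem hasKraus_traceRight : HasKraus (traceRight m k) := by
  refine ⟨k, inferInstance, fun c => Matrix.of fun v a => if a = (v, c) then 1 else 0, ?_, ?_⟩
  · ext1 ρ
    ext v w
    simp [traceRight, conjBy, Matrix.sum_apply, Matrix.mul_apply]
  · have h : ∑ c : k, (Matrix.of fun (v : m) (a : m × k) => if a = (v, c) then (1 : ℂ) else 0)ᴴ *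
        (Matrix.of fun (v : m) (a : m × k) => if a = (v, c) then (1 : ℂ) else 0) = 1 := by
      ext a b
      simp [Matrix.sum_apply, Matrix.mul_apply, Matrix.one_apply, Prod.ext_iff, ite_and,
        apply_ite (starRingEnd ℂ)]
    rw [h, sub_self]
    exact Matrix.PosSemidef.zero

/-- Apply `Φ` to the first factor; if it fails, discard its outcome and return that of `Ψ` on the
second factor. -/
noncomputable def tryOp (Φ : SuperOp m n) (Ψ : SuperOp m' n) : SuperOp (m × m') n :=
  superOp fun a b => (ketbra a.2 b.2).trace • Φ (ketbra a.1 b.1) +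
    ((ketbra a.1 b.1).trace - (Φ (ketbra a.1 b.1)).trace) • Ψ (ketbra a.2 b.2)

/-- The failure probability `ρ ↦ tr ρ - tr (Φ ρ)` is `ρ ↦ tr (B† B ρ)` with
`B† B = 1 - ∑ i, (K i)† (K i)`, so the rows of `B` provide the Kraus operators of the second
summand. -/
theorem HasKraus.tryOp {Φ : SuperOp m n} {Ψ : SuperOp m' n}
    (hΦ : HasKraus Φ) (hΨ : HasKraus Ψ) : HasKraus (tryOp Φ Ψ) := by
  obtain ⟨ι, _, K, rfl, hK⟩ := hΦ
  obtain ⟨κ, _, L, rfl, hL⟩ := hΨ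
  obtain ⟨B, hB⟩ := exists_eq_conjTranspose_mul_self hK
  have hB' := Matrix.posSemidef_conjTranspose_mul_self B
  refine ⟨(ι × m') ⊕ (m × κ), inferInstance, Sum.elim
    (fun i => Matrix.of fun v a => if a.2 = i.2 then K i.1 v a.1 else 0)
    (fun j => Matrix.of fun v a => B j.1 a.1 * L j.2 v a.2), ?_, ?_⟩
  · refine superOp_eq_iff.2 fun a b => ?_
    have h₁ : (ketbra a.1 b.1).trace - ((∑ i, conjBy (K i)) (ketbra a.1 b.1)).trace =
        ∑ r, B r a.1 * star (B r b.1) := by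
      rw [trace_sum_conjBy, ← Matrix.trace_sub]
      nth_rw 1 [← Matrix.one_mul (ketbra a.1 b.1)]
      rw [← Matrix.sub_mul, hB]
      simp only [ketbra, Matrix.trace_mul_single, Matrix.mul_apply, Matrix.conjTranspose_apply]
      simp [mul_comm]
    have h₂ : (ketbra a.2 b.2).trace = if b.2 = a.2 then 1 else 0 := by
      simp [ketbra, Matrix.trace, Matrix.single_apply, ite_and, eq_comm]
    rw [h₁, h₂]
    ext v w
    simp only [Fintype.sum_sum_type, Sum.elim_inl, Sum.elim_inr, LinearMap.add_apply,
      LinearMap.sum_apply, Matrix.add_apply, Matrix.smul_apply, Matrix.sum_apply,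
      conjBy_ketbra_apply, Matrix.of_apply, Fintype.sum_prod_type, smul_eq_mul]
    congr 1
    · rw [Finset.mul_sum]
      refine Finset.sum_congr rfl fun i _ => ?_
      rw [Finset.sum_eq_single a.2] <;> simp +contextual [eq_comm, apply_ite (starRingEnd ℂ)]
    · rw [Finset.sum_mul_sum]
      exact Finset.sum_congr rfl fun i _ => Finset.sum_congr rfl fun j _ => by
        rw [star_mul']; ring
  -- With `S = ∑ (K i)† (K i)` and `R = ∑ (L j)† (L j)`, the sum over the whole family is
  -- `S ⊗ 1 + B† B ⊗ R`, which falls short of `1 = (S + B† B) ⊗ 1` by `B† B ⊗ (1 - R)`.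
  · have h₁ : (1 : Matrix (m × m') (m × m') ℂ) =
        (∑ i, (K i)ᴴ * K i) ⊗ₖ 1 + ((Bᴴ * B) ⊗ₖ (1 - ∑ j, (L j)ᴴ * L j) +
          (Bᴴ * B) ⊗ₖ (∑ j, (L j)ᴴ * L j)) := by
      rw [← Matrix.kronecker_add, sub_add_cancel, ← Matrix.add_kronecker, ← hB, add_sub_cancel,
        Matrix.one_kronecker_one]
    have h₂ : ∀ E F G : Matrix (m × m') (m × m') ℂ, E + (F + G) - (E + G) = F := by
      intro E F G
      abel
    rw [Fintype.sum_sum_type]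
    simp only [Sum.elim_inl, Sum.elim_inr]
    refine Eq.subst (motive := fun M : Matrix (m × m') (m × m') ℂ => M.PosSemidef) ?_
      (hB'.kronecker hL)
    rw [← h₂ ((∑ i, (K i)ᴴ * K i) ⊗ₖ 1) ((Bᴴ * B) ⊗ₖ (1 - ∑ j, (L j)ᴴ * L j))
      ((Bᴴ * B) ⊗ₖ (∑ j, (L j)ᴴ * L j)), ← h₁]
    congr 2
    · ext a b
      by_cases hab : a.2 = b.2 <;>
        simp [Matrix.sum_apply, Matrix.mul_apply, Fintype.sum_prod_type, Matrix.one_apply, hab]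
    · ext a b
      simp only [Matrix.sum_apply, Matrix.mul_apply, Fintype.sum_prod_type, Finset.sum_mul,
        Matrix.kroneckerMap_apply, Matrix.conjTranspose_apply, Matrix.of_apply, Finset.mul_sum]
      symm
      rw [Finset.sum_comm]
      refine Finset.sum_congr rfl fun i _ => ?_
      rw [Finset.sum_comm]
      refine Finset.sum_congr rfl fun v _ => Finset.sum_congr rfl fun r _ => ?_
      rw [star_mul']
      ring

end Decomposition

universe u

variable {X : Type u}

/-! ### Induction on derivations of pure expressions -/

/-- Induction on derivations of pure expressions that ignores the derivations of mixed expressions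
and of programs in their premises. -/
@[elab_as_elim]
theorem PureExp.induction {P : ∀ {Γ Δ : Ctx X} {e : Exp X} {T : Ty}, PureExp Γ Δ e T → Prop}
    (unit : ∀ {Γ : Ctx X} (hΓ : Γ.WF), P (PureExp.unit hΓ))
    (cvar : ∀ {Γ Γ' : Ctx X} {x : X} {T : Ty} (hΓ : Ctx.WF (Γ ++ (x, T) :: Γ')),
      P (PureExp.cvar hΓ))
    (qvar : ∀ {Γ : Ctx X} {x : X} {T : Ty} (hΓ : Γ.WF) (hx : x ∉ Γ.dom),
      P (PureExp.qvar (T := T) hΓ hx))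
    (pair : ∀ {Γ Δ Δ₀ Δ₁ : Ctx X} {e₀ e₁ : Exp X} {T₀ T₁ : Ty}
      (hΔ : Ctx.WF (Δ ++ (Δ₀ ++ Δ₁)))
      (d₀ : PureExp Γ (Δ ++ Δ₀) e₀ T₀) (d₁ : PureExp Γ (Δ ++ Δ₁) e₁ T₁),
      P d₀ → P d₁ → P (PureExp.pair hΔ d₀ d₁))
    (ctrl : ∀ {n : ℕ} {Γ Γ' Δ Δ' : Ctx X} {Γj : Fin n → Ctx X} {e : Exp X}
      {p b : Fin n → Exp X} {T T' : Ty}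
      (hΓ : Ctx.WF (Γ ++ Γ')) (hΔ : Ctx.WF (Δ ++ Δ')) (d : MixedExp (Γ ++ Δ) e T)
      (ho : Ortho T (List.ofFn p)) (dp : ∀ j, PureExp [] (Γj j) (p j) T)
      (he : ∀ x ∈ Δ.dom, Erases x T' (List.ofFn b))
      (db : ∀ j, PureExp ((Γ ++ Γ') ++ Γj j) (Δ ++ Δ') (b j) T'),
      (∀ j, P (dp j)) → (∀ j, P (db j)) → P (PureExp.ctrl hΓ hΔ d ho dp he db))
    (app : ∀ {Γ Δ : Ctx X} {f : Prog X} {e : Exp X} {T T' : Ty}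
      (df : PureProg f T T') (de : PureExp Γ Δ e T), P de → P (PureExp.app df de))
    (perm : ∀ {Γ Γp Δ Δp : Ctx X} {e : Exp X} {T : Ty}
      (πg : CtxPerm Γ Γp) (πd : CtxPerm Δ Δp) (d : PureExp Γ Δ e T), P d →
      P (PureExp.perm πg πd d))
    {Γ Δ : Ctx X} {e : Exp X} {T : Ty} (d : PureExp Γ Δ e T) : P d :=
  PureExp.rec (motive_1 := fun _ _ _ _ d => P d) (motive_2 := fun _ _ _ _ => True)
    (motive_3 := fun _ _ _ _ => True) (motive_4 := fun _ _ _ _ => True)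
    unit cvar qvar pair (fun hΓ hΔ d ho dp he db _ => ctrl hΓ hΔ d ho dp he db)
    (fun df de _ => app df de) perm
    (fun _ _ => trivial) (fun _ _ _ => trivial) (fun _ _ _ _ _ => trivial)
    (fun _ _ _ _ _ => trivial) (fun _ _ _ _ => trivial) (fun _ _ _ => trivial)
    (fun _ _ => trivial) (fun _ _ => trivial) (fun _ _ _ _ => trivial) (fun _ _ _ _ => trivial)
    (fun _ _ => trivial) (fun _ _ _ _ => trivial) d

/-! ### Contexts and valuations -/

theorem Ctx.dom_append (Γ Δ : Ctx X) : Ctx.dom (Γ ++ Δ) = Γ.dom ++ Δ.dom := List.map_append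

theorem CtxPerm.perm {Γ Γ' : Ctx X} (π : CtxPerm Γ Γ') : Γ.Perm Γ' := by
  induction π with
  | nil => exact .nil
  | cons b _ ih => exact ih.cons b
  | swap b c Γ => exact .swap c b Γ
  | trans _ _ ih ih' => exact ih.trans ih'

theorem CtxPerm.mem_dom_iff {Γ Γ' : Ctx X} (π : CtxPerm Γ Γ') {x : X} :
    x ∈ Γ.dom ↔ x ∈ Γ'.dom :=
  (π.perm.map Prod.fst).mem_iff

@[simp]
theorem Ctx.Val.fst_cat {Γ Δ : Ctx X} (σ : Ctx.Val Γ) (τ : Ctx.Val Δ) : (σ.cat τ).fst = σ := by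
  simp [Ctx.Val.fst, Ctx.Val.cat]

@[simp]
theorem Ctx.Val.snd_cat {Γ Δ : Ctx X} (σ : Ctx.Val Γ) (τ : Ctx.Val Δ) : (σ.cat τ).snd = τ := by
  simp [Ctx.Val.snd, Ctx.Val.cat]

@[simp]
theorem Ctx.Val.cat_fst_snd {Γ Δ : Ctx X} (τ : Ctx.Val (Γ ++ Δ)) : τ.fst.cat τ.snd = τ := by
  simp [Ctx.Val.fst, Ctx.Val.snd, Ctx.Val.cat]

theorem Ctx.Val.cat_eq_cat_iff {Γ Δ : Ctx X} {σ σ' : Ctx.Val Γ} {τ τ' : Ctx.Val Δ} :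
    σ.cat τ = σ'.cat τ' ↔ σ = σ' ∧ τ = τ' := by
  simp [Ctx.Val.cat]

/-- The duplication `|τ, τ₀, τ₁⟩ ↦ |τ, τ₀⟩ ⊗ |τ, τ₁⟩` of the shared part of a context. -/
def share (Δ Δ₀ Δ₁ : Ctx X) (τ : Ctx.Val (Δ ++ (Δ₀ ++ Δ₁))) :
    Ctx.Val (Δ ++ Δ₀) × Ctx.Val (Δ ++ Δ₁) :=
  (τ.fst.cat τ.snd.fst, τ.fst.cat τ.snd.snd)

theorem share_injective (Δ Δ₀ Δ₁ : Ctx X) : (share Δ Δ₀ Δ₁).Injective := by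
  intro τ τ' h
  simp only [share, Prod.mk.injEq, Ctx.Val.cat_eq_cat_iff] at h
  rw [← τ.cat_fst_snd, ← τ'.cat_fst_snd, ← τ.snd.cat_fst_snd, ← τ'.snd.cat_fst_snd, h.1.1, h.1.2,
    h.2.2]

/-! ### Patterns -/

/-- Patterns, the shapes of expressions that occur in spanning lists. The disjointness of variables
in the two components of a pair is not recorded. -/
inductive Exp.IsPattern : Exp X → Prop
  | unit : IsPattern Exp.unit
  | var (x : X) : IsPattern (Exp.var x)
  | pair {e₀ e₁ : Exp X} : IsPattern e₀ → IsPattern e₁ → IsPattern (Exp.pair e₀ e₁)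
  | left {e : Exp X} (T₀ T₁ : Ty) : IsPattern e → IsPattern (Exp.app (Prog.left T₀ T₁) e)
  | right {e : Exp X} (T₀ T₁ : Ty) : IsPattern e → IsPattern (Exp.app (Prog.right T₀ T₁) e)

/-- The value `v` has the shape of the pattern `e`: the constructors that `e` prescribes occur in
`v`. Types in the annotations of `left` and `right` are ignored, and the relation holds by
convention where `e` is not a pattern or is not of type `T`. -/
def Exp.Matches : Exp X → (T : Ty) → T.Val → Prop
  | .pair e₀ e₁, .prod T₀ T₁, v => e₀.Matches T₀ v.1 ∧ e₁.Matches T₁ v.2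
  | .app (.left _ _) e, .sum T₀ _, .inl v => e.Matches T₀ v
  | .app (.left _ _) _, .sum _ _, .inr _ => False
  | .app (.right _ _) e, .sum _ T₁, .inr v => e.Matches T₁ v
  | .app (.right _ _) _, .sum _ _, .inl _ => False
  | _, _, _ => True

theorem Spanning.isPattern {T : Ty} {es : List (Exp X)} (h : Spanning T es) :
    ∀ e ∈ es, e.IsPattern := by
  induction h with
  | void => simp
  | unit => simpa using Exp.IsPattern.unit
  | var T x => simpa using Exp.IsPattern.var x
  | sum _ _ ih ih' =>
    intro e he
    rcases List.mem_append.1 he with he | he <;> obtain ⟨e₁, he₁, rfl⟩ := List.mem_map.1 he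
    · exact (ih e₁ he₁).left _ _
    · exact (ih' e₁ he₁).right _ _
  | pair es _ _ _ ih ih' =>
    intro e he
    obtain ⟨q, hq, he⟩ := List.mem_flatMap.1 he
    obtain ⟨e', he', rfl⟩ := List.mem_map.1 he
    exact (ih _ (List.mem_map_of_mem hq)).pair (ih' q hq e' he')
  | perm hp _ ih => exact fun e he => ih e (hp.mem_iff.2 he)

/-- No value matches two patterns of a spanning list. -/
theorem Spanning.pairwise_not_matches {T : Ty} {es : List (Exp X)} (h : Spanning T es) :
    es.Pairwise fun e e' => ∀ v, e.Matches T v → ¬ e'.Matches T v := by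
  induction h with
  | void => simp
  | unit => simp
  | var T x => simp
  | sum _ _ ih ih' =>
    refine List.pairwise_append.2 ⟨List.pairwise_map.2 (ih.imp ?_),
      List.pairwise_map.2 (ih'.imp ?_), ?_⟩
    · rintro e e' h (v | v) hv hv'
      · exact h v hv hv'
      · exact hv
    · rintro e e' h (v | v) hv hv'
      · exact hv
      · exact h v hv hv'
    · intro e he e' he'
      obtain ⟨e, -, rfl⟩ := List.mem_map.1 he
      obtain ⟨e', -, rfl⟩ := List.mem_map.1 he'
      rintro (v | v) hv hv'
      · exact hv'
      · exact hv
  | pair es _ _ _ ih ih' =>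
    refine List.pairwise_flatMap.2 ⟨fun q hq => List.pairwise_map.2 ((ih' q hq).imp ?_),
      (List.pairwise_map.1 ih).imp ?_⟩
    · rintro e e' h v ⟨-, hv⟩ ⟨-, hv'⟩
      exact h _ hv hv'
    · intro q q' h e he e' he'
      obtain ⟨e, -, rfl⟩ := List.mem_map.1 he
      obtain ⟨e', -, rfl⟩ := List.mem_map.1 he'
      rintro v ⟨hv, -⟩ ⟨hv', -⟩
      exact h _ hv hv'
  | perm hp _ ih => exact ih.perm hp fun h v hv hv' => h v hv' hv

theorem Ortho.isPattern {T : Ty} {n : ℕ} {p : Fin n → Exp X} (h : Ortho T (List.ofFn p))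
    (j : Fin n) : (p j).IsPattern := by
  obtain ⟨es, hes, hs⟩ := h
  exact hes.isPattern _ (hs.subset (List.mem_ofFn.2 ⟨j, rfl⟩))

theorem Ortho.eq_of_matches {T : Ty} {n : ℕ} {p : Fin n → Exp X} (h : Ortho T (List.ofFn p))
    {i j : Fin n} {v : T.Val} (hi : (p i).Matches T v) (hj : (p j).Matches T v) : i = j := by
  obtain ⟨es, hes, hs⟩ := h
  have hp := List.pairwise_ofFn.1 (hes.pairwise_not_matches.sublist hs)
  by_contra hij
  rcases lt_or_gt_of_ne hij with h | h
  · exact hp h v hi hj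
  · exact hp h v hj hi

/-- Typing is relevant: every variable of the quantum context is used. Only the case of patterns is
needed. -/
theorem PureExp.dom_subset_fv {Γ Δ : Ctx X} {e : Exp X} {T : Ty} (d : PureExp Γ Δ e T)
    (he : e.IsPattern) : ∀ x ∈ Δ.dom, x ∈ e.fv := by
  induction d using PureExp.induction with
  | unit hΓ => simp [Ctx.dom]
  | cvar hΓ => simp [Ctx.dom]
  | qvar hΓ hx => simp [Ctx.dom, Exp.fv]
  | pair hΔ d₀ d₁ ih₀ ih₁ =>
    cases he with
    | pair he₀ he₁ =>
      intro x hx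
      simp only [Ctx.dom_append, List.mem_append, Exp.fv, Set.mem_union] at *
      have := ih₀ he₀ x
      have := ih₁ he₁ x
      tauto
  | ctrl => cases he
  | app df de ih =>
    cases he with
    | left _ _ he => exact ih he
    | right _ _ he => exact ih he
  | perm πg πd d ih => exact fun x hx => ih he x (πd.mem_dom_iff.2 hx)

/-- A pattern denotes an injection of the valuations of its variables into the values that match
it. -/
theorem PureExp.sem_eq_basisOp_of_isPattern {Γ Δ : Ctx X} {e : Exp X} {T : Ty}
    (d : PureExp Γ Δ e T) (hΓ : Γ = []) (he : e.IsPattern) (σ : Ctx.Val Γ) :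
    ∃ f : Ctx.Val Δ → T.Val, f.Injective ∧ d.sem σ = basisOp f ∧ ∀ τ, e.Matches T (f τ) := by
  induction d using PureExp.induction with
  | unit hΓ => exact ⟨fun _ => (), fun _ _ _ => rfl, rfl, fun _ => trivial⟩
  | cvar => simp at hΓ
  | @qvar _ x T _ hx =>
    refine ⟨fun τ => τ.head, fun τ τ' h => Prod.ext h rfl, rfl, fun τ => ?_⟩
    cases T <;> trivial
  | pair hΔ d₀ d₁ ih₀ ih₁ =>
    cases he with
    | pair he₀ he₁ =>
      obtain ⟨f₀, hf₀, hs₀, hm₀⟩ := ih₀ hΓ he₀ σ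
      obtain ⟨f₁, hf₁, hs₁, hm₁⟩ := ih₁ hΓ he₁ σ
      refine ⟨Prod.map f₀ f₁ ∘ share _ _ _, (hf₀.prodMap hf₁).comp (share_injective _ _ _), ?_,
        fun τ => ⟨hm₀ _, hm₁ _⟩⟩
      ext v τ
      simp only [PureExp.sem, hs₀, hs₁, basisOp, Matrix.of_apply, share, Function.comp_apply,
        Prod.map_apply, Prod.ext_iff]
      split_ifs <;> simp_all
  | ctrl => cases he
  | app df de ih =>
    cases he with
    | left _ _ he =>
      cases df
      obtain ⟨f, hf, hs, hm⟩ := ih hΓ he σ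
      exact ⟨Sum.inl ∘ f, Sum.inl_injective.comp hf,
        (congrArg _ hs).trans (basisOp_mul_basisOp _ _), hm⟩
    | right _ _ he =>
      cases df
      obtain ⟨f, hf, hs, hm⟩ := ih hΓ he σ
      exact ⟨Sum.inr ∘ f, Sum.inr_injective.comp hf,
        (congrArg _ hs).trans (basisOp_mul_basisOp _ _), hm⟩
  | perm πg πd d ih =>
    obtain ⟨f, hf, hs, hm⟩ := ih (List.perm_nil.1 (hΓ ▸ πg.perm)) he (πg.val.symm σ)
    refine ⟨f ∘ πd.val.symm, hf.comp πd.val.symm.injective, ?_, fun τ => hm _⟩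
    ext v τ
    simp [PureExp.sem, hs, basisOp]

/-! ### Erasure -/

/-- `Binds x Δ τ y`: the valuation `τ` of `Δ` gives the variable `x` the value `y`, which is paired
with its type. -/
def Binds (x : X) : (Δ : Ctx X) → Ctx.Val Δ → (Σ T : Ty, T.Val) → Prop
  | [], _, _ => False
  | b :: Δ, τ, y => (b.1 = x ∧ y = ⟨b.2, τ.1⟩) ∨ Binds x Δ τ.2 y

theorem binds_append {x : X} {y : Σ T : Ty, T.Val} {Γ Δ : Ctx X} {τ : Ctx.Val (Γ ++ Δ)} :
    Binds x (Γ ++ Δ) τ y ↔ Binds x Γ τ.fst y ∨ Binds x Δ τ.snd y := by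
  induction Γ with
  | nil => exact (iff_of_eq (false_or _)).symm
  | cons b Γ ih =>
    refine (or_congr_right (ih (τ := τ.2))).trans ?_
    exact or_assoc.symm

theorem binds_perm {x : X} {y : Σ T : Ty, T.Val} {Γ Γ' : Ctx X} (π : CtxPerm Γ Γ')
    (τ : Ctx.Val Γ) : Binds x Γ' (π.val τ) y ↔ Binds x Γ τ y := by
  induction π with
  | nil => exact Iff.rfl
  | cons b π ih => exact or_congr_right (ih τ.2)
  | swap b c Γ => exact or_left_comm
  | trans π π' ih ih' => exact (ih' (π.val τ)).trans (ih τ)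

theorem Binds.mem_dom {x : X} {y : Σ T : Ty, T.Val} {Δ : Ctx X} {τ : Ctx.Val Δ}
    (h : Binds x Δ τ y) : x ∈ Δ.dom := by
  induction Δ with
  | nil => exact h.elim
  | cons b Δ ih =>
    rcases h with ⟨rfl, -⟩ | h
    · exact List.mem_cons_self
    · exact List.mem_cons_of_mem _ (ih h)

/-- Valuations that give the same values to all variables are equal. -/
theorem eq_of_binds {Δ : Ctx X} (hΔ : Δ.WF) {τ τ' : Ctx.Val Δ}
    (h : ∀ x ∈ Δ.dom, ∃ y, Binds x Δ τ y ∧ Binds x Δ τ' y) : τ = τ' := by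
  induction Δ with
  | nil => rfl
  | cons b Δ ih =>
    have hb : b.1 ∉ Ctx.dom Δ := (List.nodup_cons.1 hΔ).1
    refine Prod.ext ?_ (ih (List.nodup_cons.1 hΔ).2 fun x hx => ?_)
    · obtain ⟨y, hy, hy'⟩ := h b.1 List.mem_cons_self
      rcases hy with ⟨-, hy⟩ | hy
      · rcases hy' with ⟨-, hy'⟩ | hy'
        · exact eq_of_heq (Sigma.mk.inj (hy.symm.trans hy')).2
        · exact (hb hy'.mem_dom).elim
      · exact (hb hy.mem_dom).elim
    · obtain ⟨y, hy, hy'⟩ := h x (List.mem_cons_of_mem _ hx)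
      have hne : b.1 ≠ x := fun h => hb (h ▸ hx)
      exact ⟨y, hy.resolve_left fun h => hne h.1, hy'.resolve_left fun h => hne h.1⟩

theorem fst_eq_of_binds {Δ Δ' : Ctx X} (hΔ : Ctx.WF (Δ ++ Δ')) {τ τ' : Ctx.Val (Δ ++ Δ')}
    (h : ∀ x ∈ Δ.dom, ∃ y, Binds x (Δ ++ Δ') τ y ∧ Binds x (Δ ++ Δ') τ' y) :
    τ.fst = τ'.fst := by
  rw [Ctx.WF, Ctx.dom_append, List.nodup_append'] at hΔ
  refine eq_of_binds hΔ.1 fun x hx => ?_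
  obtain ⟨y, hy, hy'⟩ := h x hx
  exact ⟨y, (binds_append.1 hy).resolve_right fun h => hΔ.2.2 hx h.mem_dom,
    (binds_append.1 hy').resolve_right fun h => hΔ.2.2 hx h.mem_dom⟩

theorem PureExp.exists_sem_branch_ne_zero {n : ℕ} {Γ Γ' Δ Δ' : Ctx X} {Γj : Fin n → Ctx X}
    {e : Exp X} {p b : Fin n → Exp X} {T T' : Ty}
    {hΓ : Ctx.WF (Γ ++ Γ')} {hΔ : Ctx.WF (Δ ++ Δ')} {d : MixedExp (Γ ++ Δ) e T}
    {ho : Ortho T (List.ofFn p)} {dp : ∀ j, PureExp [] (Γj j) (p j) T}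
    {he : ∀ x ∈ Δ.dom, Erases x T' (List.ofFn b)}
    {db : ∀ j, PureExp ((Γ ++ Γ') ++ Γj j) (Δ ++ Δ') (b j) T'}
    {σ : Ctx.Val (Γ ++ Γ')} {v : T'.Val} {τ : Ctx.Val (Δ ++ Δ')}
    (h : (PureExp.ctrl hΓ hΔ d ho dp he db).sem σ v τ ≠ 0) :
    ∃ j σj, (db j).sem (σ.cat σj) v τ ≠ 0 := by
  contrapose! h
  simp [PureExp.sem, h]

/-- The typing rules do not force the classical and the quantum context to be disjoint: a `ctrl`
without branches leaves them unrelated. But then the denotation vanishes. -/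
theorem PureExp.sem_eq_zero_of_mem_dom {Γ Δ : Ctx X} {e : Exp X} {T : Ty} (d : PureExp Γ Δ e T)
    (σ : Ctx.Val Γ) {x : X} (hx : x ∈ Γ.dom) (hx' : x ∈ Δ.dom) : d.sem σ = 0 := by
  induction d using PureExp.induction with
  | unit => simp [Ctx.dom] at hx'
  | cvar => simp [Ctx.dom] at hx'
  | qvar _ hx₀ =>
    simp only [Ctx.dom, List.map_cons, List.map_nil, List.mem_singleton] at hx'
    exact (hx₀ (hx' ▸ hx)).elim
  | pair hΔ d₀ d₁ ih₀ ih₁ =>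
    ext v τ
    simp only [Ctx.dom_append, List.mem_append] at hx' ih₀ ih₁
    rcases hx' with hx' | hx' | hx'
    · simp [PureExp.sem, ih₀ σ hx (.inl hx')]
    · simp [PureExp.sem, ih₀ σ hx (.inr hx')]
    · simp [PureExp.sem, ih₁ σ hx (.inr hx')]
  | ctrl hΓ hΔ d ho dp he db _ ih =>
    ext v τ
    by_contra hne
    obtain ⟨j, σj, hj⟩ := exists_sem_branch_ne_zero hne
    refine hj ?_
    rw [ih j _ (by rw [Ctx.dom_append]; exact List.mem_append_left _ hx) hx', Matrix.zero_apply]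
  | app df de ih => simp [PureExp.sem, ih σ hx hx']
  | perm πg πd d ih =>
    ext v τ
    simp [PureExp.sem, ih (πg.val.symm σ) (πg.mem_dom_iff.2 hx) (πd.mem_dom_iff.2 hx')]

/-- The value of `x` can be read off from the outcome of `e` by the function `g`: whenever `e` maps
`|τ⟩` to a superposition that involves the outcome `v`, the value of `x` in `τ` is `g v`. In
particular `x` is bound by the quantum context of any such derivation. Working with values paired
with their types lets one `g` serve derivations of all types. -/
def Exp.Exposes (x : X) (g : (Σ T : Ty, T.Val) → Σ T : Ty, T.Val) (e : Exp X) : Prop :=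
  ∀ ⦃Γ Δ : Ctx X⦄ ⦃T : Ty⦄ (d : PureExp Γ Δ e T) (σ : Ctx.Val Γ) (v : T.Val) (τ : Ctx.Val Δ),
    x ∉ Γ.dom → d.sem σ v τ ≠ 0 → Binds x Δ τ (g ⟨T, v⟩)

/-- The first component of a value of a product type; other values are left unchanged. -/
def Ty.fstVal : (Σ T : Ty, T.Val) → Σ T : Ty, T.Val
  | ⟨.prod T₀ _, v⟩ => ⟨T₀, v.1⟩
  | y => y

/-- The second component of a value of a product type; other values are left unchanged. -/
def Ty.sndVal : (Σ T : Ty, T.Val) → Σ T : Ty, T.Val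
  | ⟨.prod _ T₁, v⟩ => ⟨T₁, v.2⟩
  | y => y

theorem Exp.exposes_var (x : X) : (Exp.var x).Exposes x id := by
  intro Γ Δ T d σ v τ hx hv
  generalize he : Exp.var x = e at d
  induction d using PureExp.induction with
  | cvar =>
    cases he
    simp [Ctx.dom] at hx
  | qvar =>
    cases he
    refine Or.inl ⟨rfl, ?_⟩
    by_contra hne
    exact hv (if_neg fun h => hne (congrArg (Sigma.mk _) h))
  | perm πg πd d ih =>
    have h := ih (πg.val.symm σ) v (πd.val.symm τ) (fun h => hx (πg.mem_dom_iff.1 h)) he hv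
    rwa [← binds_perm πd, Equiv.apply_symm_apply] at h
  | unit | pair | ctrl | app => cases he

theorem Exp.Exposes.gphase {x : X} {g : (Σ T : Ty, T.Val) → Σ T : Ty, T.Val} {e₀ : Exp X}
    (h₀ : e₀.Exposes x g) (T₀ : Ty) (y : X) (r : ℝ) :
    (Exp.app (Prog.gphase T₀ y r) e₀).Exposes x g := by
  intro Γ Δ T d σ v τ hx hv
  generalize he : Exp.app (Prog.gphase T₀ y r) e₀ = e at d
  induction d using PureExp.induction with
  | app df de ih =>
    obtain ⟨rfl, rfl⟩ := Exp.app.inj he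
    unfold Prog.gphase at df
    cases df
    refine h₀ de σ v τ hx fun h => hv ?_
    simp [PureExp.sem, PureProg.sem, ← smul_add, h]
  | perm πg πd d ih =>
    have h := ih (πg.val.symm σ) v (πd.val.symm τ) (fun h => hx (πg.mem_dom_iff.1 h)) he hv
    rwa [← binds_perm πd, Equiv.apply_symm_apply] at h
  | unit | cvar | qvar | pair | ctrl => cases he

theorem Exp.Exposes.ctrl {x : X} {g : (Σ T : Ty, T.Val) → Σ T : Ty, T.Val} {n : ℕ} {e₀ : Exp X}
    {T₀ T₁ : Ty} {p₀ b₀ : Fin n → Exp X} (hp : ∀ j, x ∉ (p₀ j).fv)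
    (hb : ∀ j, (b₀ j).Exposes x g) : (Exp.ctrl e₀ T₀ p₀ b₀ T₁).Exposes x g := by
  intro Γ Δ T d σ v τ hx hv
  generalize he : Exp.ctrl e₀ T₀ p₀ b₀ T₁ = e at d
  induction d using PureExp.induction with
  | ctrl hΓ hΔ d ho dp he db =>
    cases he
    obtain ⟨j, σj, hj⟩ := PureExp.exists_sem_branch_ne_zero hv
    refine hb j (db j) _ v τ ?_ hj
    rw [Ctx.dom_append, List.mem_append]
    exact not_or.2 ⟨hx, fun h => hp j ((dp j).dom_subset_fv (ho.isPattern j) x h)⟩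
  | perm πg πd d ih =>
    have h := ih (πg.val.symm σ) v (πd.val.symm τ) (fun h => hx (πg.mem_dom_iff.1 h)) he hv
    rwa [← binds_perm πd, Equiv.apply_symm_apply] at h
  | unit | cvar | qvar | pair | app => cases he

theorem Exp.Exposes.pair_left {x : X} {g : (Σ T : Ty, T.Val) → Σ T : Ty, T.Val} {e₀ e₁ : Exp X}
    (h₀ : e₀.Exposes x g) : (Exp.pair e₀ e₁).Exposes x (g ∘ Ty.fstVal) := by
  intro Γ Δ T d σ v τ hx hv
  generalize he : Exp.pair e₀ e₁ = e at d
  induction d using PureExp.induction with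
  | pair hΔ d₀ d₁ =>
    obtain ⟨rfl, rfl⟩ := Exp.pair.inj he
    have h := h₀ d₀ σ v.1 _ hx (left_ne_zero_of_mul hv)
    simp only [binds_append, Ctx.Val.fst_cat, Ctx.Val.snd_cat] at h ⊢
    exact h.imp_right Or.inl
  | perm πg πd d ih =>
    have h := ih (πg.val.symm σ) v (πd.val.symm τ) (fun h => hx (πg.mem_dom_iff.1 h)) he hv
    rwa [← binds_perm πd, Equiv.apply_symm_apply] at h
  | unit | cvar | qvar | ctrl | app => cases he

theorem Exp.Exposes.pair_right {x : X} {g : (Σ T : Ty, T.Val) → Σ T : Ty, T.Val}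
    {e₀ e₁ : Exp X} (h₁ : e₁.Exposes x g) : (Exp.pair e₀ e₁).Exposes x (g ∘ Ty.sndVal) := by
  intro Γ Δ T d σ v τ hx hv
  generalize he : Exp.pair e₀ e₁ = e at d
  induction d using PureExp.induction with
  | pair hΔ d₀ d₁ =>
    obtain ⟨rfl, rfl⟩ := Exp.pair.inj he
    have h := h₁ d₁ σ v.2 _ hx (right_ne_zero_of_mul hv)
    simp only [binds_append, Ctx.Val.fst_cat, Ctx.Val.snd_cat] at h ⊢
    exact h.imp_right Or.inr
  | perm πg πd d ih =>
    have h := ih (πg.val.symm σ) v (πd.val.symm τ) (fun h => hx (πg.mem_dom_iff.1 h)) he hv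
    rwa [← binds_perm πd, Equiv.apply_symm_apply] at h
  | unit | cvar | qvar | ctrl | app => cases he

/-- The variable erased by a list of branches can be recovered from the outcome, by the same
function for all branches. -/
theorem Erases.exists_exposes {x : X} {T : Ty} {es : List (Exp X)} (h : Erases x T es) :
    ∃ g, ∀ e ∈ es, e.Exposes x g := by
  induction h with
  | var T n =>
    refine ⟨id, fun e he => ?_⟩
    rw [List.eq_of_mem_replicate he]
    exact Exp.exposes_var x
  | gphase es es' e y r _ ih =>
    obtain ⟨g, hg⟩ := ih
    simp only [List.mem_append, List.mem_cons] at hg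
    refine ⟨g, fun e' he' => ?_⟩
    simp only [List.mem_append, List.mem_cons] at he'
    rcases he' with he' | rfl | he'
    · exact hg _ (.inl he')
    · exact (hg _ (.inr (.inl rfl))).gphase _ _ _
    · exact hg _ (.inr (.inr he'))
  | ctrl es es' e p b hp _ ih =>
    obtain ⟨g, hg⟩ := ih
    simp only [List.mem_append, List.mem_ofFn] at hg
    refine ⟨g, fun e' he' => ?_⟩
    simp only [List.mem_append, List.mem_cons] at he'
    rcases he' with he' | rfl | he'
    · exact hg _ (.inl (.inl he'))
    · exact Exp.Exposes.ctrl hp fun j => hg _ (.inl (.inr ⟨j, rfl⟩))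
    · exact hg _ (.inr he')
  | pair₀ es _ ih =>
    obtain ⟨g, hg⟩ := ih
    refine ⟨g ∘ Ty.fstVal, fun e he => ?_⟩
    obtain ⟨q, hq, rfl⟩ := List.mem_map.1 he
    exact (hg _ (List.mem_map_of_mem hq)).pair_left
  | pair₁ es _ ih =>
    obtain ⟨g, hg⟩ := ih
    refine ⟨g ∘ Ty.sndVal, fun e he => ?_⟩
    obtain ⟨q, hq, rfl⟩ := List.mem_map.1 he
    exact (hg _ (List.mem_map_of_mem hq)).pair_right

/-! ### The typing rules preserve the invariants -/

/-- For fixed values `t` of the erased variables, the operator is a subconvex combination of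
branches, because each outcome `v` of the scrutinee selects at most one branch and one valuation of
its pattern. By erasure, the outputs for different `t` have disjoint supports, so that these
operators are blocks of a Kraus operator. -/
theorem PureExp.isKraus_sem_ctrl {n : ℕ} {Γ Γ' Δ Δ' : Ctx X} {Γj : Fin n → Ctx X}
    {e : Exp X} {p b : Fin n → Exp X} {T T' : Ty}
    (hΓ : Ctx.WF (Γ ++ Γ')) (hΔ : Ctx.WF (Δ ++ Δ')) (d : MixedExp (Γ ++ Δ) e T)
    (ho : Ortho T (List.ofFn p)) (dp : ∀ j, PureExp [] (Γj j) (p j) T)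
    (he : ∀ x ∈ Δ.dom, Erases x T' (List.ofFn b))
    (db : ∀ j, PureExp ((Γ ++ Γ') ++ Γj j) (Δ ++ Δ') (b j) T')
    (hd : HasKraus d.sem) (hb : ∀ j σ, IsKraus ((db j).sem σ)) (σ : Ctx.Val (Γ ++ Γ')) :
    IsKraus ((PureExp.ctrl hΓ hΔ d ho dp he db).sem σ) := by
  choose f hf hs hm using fun j =>
    (dp j).sem_eq_basisOp_of_isPattern rfl (ho.isPattern j) Ctx.Val.nil
  -- `C v` is the operator applied after the outcome `v`: the branch that `v` selects, or zero.
  let C : T.Val → Op (Ctx.Val (Δ ++ Δ')) T'.Val := fun v => ∑ j, ∑ σj : Ctx.Val (Γj j),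
    ((dp j).sem Ctx.Val.nil)ᴴ σj v • (db j).sem (σ.cat σj)
  have hCeq : ∀ v, C v = ∑ j, ∑ σj : Ctx.Val (Γj j),
      if v = f j σj then (db j).sem (σ.cat σj) else 0 := by
    intro v
    refine Finset.sum_congr rfl fun j _ => Finset.sum_congr rfl fun σj _ => ?_
    rw [hs, Matrix.conjTranspose_apply, basisOp, Matrix.of_apply]
    split_ifs <;> simp
  have hC : ∀ v, IsKraus (C v) := by
    intro v
    rw [hCeq]
    by_cases h : ∃ j σj, v = f j σj
    · obtain ⟨j, σj, rfl⟩ := h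
      rw [Finset.sum_eq_single j, Finset.sum_eq_single σj, if_pos rfl]
      · exact hb j _
      · exact fun σj' _ hne => if_neg fun h => hne (hf j h).symm
      · simp
      · refine fun i _ hij => Finset.sum_eq_zero fun σi _ => if_neg fun h => hij ?_
        exact ho.eq_of_matches (v := f j σj) (h ▸ hm i σi) (hm j σj)
      · simp
    · push Not at h
      simpa [h] using isKraus_zero
  -- The columns are grouped into blocks by the values `τ.fst` of the variables of `Δ`.
  refine isKraus_of_blocks (fun τ => τ.fst) (fun t => ∑ v,
    d.sem (ketbra (σ.fst.cat t) (σ.fst.cat t)) v v • C v) (fun t => ?_) (fun v τ => ?_)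
    fun v τ τ' hτ hτ' => ?_
  · exact isKraus_sum_smul (hd.diag_nonneg_and_sum_le_one _).1
      (hd.diag_nonneg_and_sum_le_one _).2 hC
  · simp [PureExp.sem, C, Matrix.sum_apply]
  · refine fst_eq_of_binds hΔ fun x hx => ?_
    obtain ⟨g, hg⟩ := (he x hx).exists_exposes
    have key : ∀ τ, (PureExp.ctrl hΓ hΔ d ho dp he db).sem σ v τ ≠ 0 →
        Binds x (Δ ++ Δ') τ (g ⟨T', v⟩) := by
      intro τ hτ
      obtain ⟨j, σj, hj⟩ := PureExp.exists_sem_branch_ne_zero hτ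
      refine hg (b j) (List.mem_ofFn.2 ⟨j, rfl⟩) (db j) _ v τ (fun hxΓ => hj ?_) hj
      rw [(db j).sem_eq_zero_of_mem_dom _ hxΓ
        (by rw [Ctx.dom_append]; exact List.mem_append_left _ hx), Matrix.zero_apply]
    exact ⟨_, key τ hτ, key τ' hτ'⟩

theorem PureExp.isKraus_sem_pair {Γ Δ Δ₀ Δ₁ : Ctx X} {e₀ e₁ : Exp X} {T₀ T₁ : Ty}
    (hΔ : Ctx.WF (Δ ++ (Δ₀ ++ Δ₁))) (d₀ : PureExp Γ (Δ ++ Δ₀) e₀ T₀)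
    (d₁ : PureExp Γ (Δ ++ Δ₁) e₁ T₁) (σ : Ctx.Val Γ) (h₀ : IsKraus (d₀.sem σ))
    (h₁ : IsKraus (d₁.sem σ)) : IsKraus ((PureExp.pair hΔ d₀ d₁).sem σ) := by
  have h : (PureExp.pair hΔ d₀ d₁).sem σ =
      (d₀.sem σ ⊗ₖ d₁.sem σ) * basisOp (share Δ Δ₀ Δ₁) := by
    ext v τ
    rw [mul_basisOp_apply]
    rfl
  rw [h]
  exact (h₀.kronecker h₁).mul (isKraus_basisOp (share_injective _ _ _))

theorem PureExp.isKraus_sem_perm {Γ Γp Δ Δp : Ctx X} {e : Exp X} {T : Ty}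
    (πg : CtxPerm Γ Γp) (πd : CtxPerm Δ Δp) (d : PureExp Γ Δ e T) (σ : Ctx.Val Γp)
    (h : IsKraus (d.sem (πg.val.symm σ))) : IsKraus ((PureExp.perm πg πd d).sem σ) := by
  have h' : (PureExp.perm πg πd d).sem σ =
      d.sem (πg.val.symm σ) * basisOp πd.val.symm := by
    ext v τ
    rw [mul_basisOp_apply]
    rfl
  rw [h']
  exact h.mul (isKraus_basisOp πd.val.symm.injective)

theorem MixedExp.hasKraus_sem_perm {Δ Δ' : Ctx X} {e : Exp X} {T : Ty} (π : CtxPerm Δ Δ')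
    (d : MixedExp Δ e T) (h : HasKraus d.sem) : HasKraus (MixedExp.perm π d).sem := by
  have h' : (MixedExp.perm π d).sem = d.sem ∘ₗ conjBy (basisOp π.val.symm) := by
    refine superOp_eq_iff.2 fun τ τ' => ?_
    rw [LinearMap.comp_apply, conjBy_basisOp_ketbra]
  rw [h']
  exact h.comp (isKraus_basisOp π.val.symm.injective).hasKraus_conjBy

theorem MixedExp.hasKraus_sem_pair {Δ Δ₀ Δ₁ : Ctx X} {e₀ e₁ : Exp X} {T₀ T₁ : Ty}
    (hΔ : Ctx.WF (Δ ++ (Δ₀ ++ Δ₁))) (d₀ : MixedExp (Δ ++ Δ₀) e₀ T₀)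
    (d₁ : MixedExp (Δ ++ Δ₁) e₁ T₁) (h₀ : HasKraus d₀.sem) (h₁ : HasKraus d₁.sem) :
    HasKraus (MixedExp.pair hΔ d₀ d₁).sem := by
  have h : (MixedExp.pair hΔ d₀ d₁).sem =
      tensorOp d₀.sem d₁.sem ∘ₗ conjBy (basisOp (share Δ Δ₀ Δ₁)) := by
    refine superOp_eq_iff.2 fun τ τ' => ?_
    rw [LinearMap.comp_apply, conjBy_basisOp_ketbra, tensorOp, superOp_ketbra]
    rfl
  rw [h]
  exact (h₀.tensorOp h₁).comp (isKraus_basisOp (share_injective _ _ _)).hasKraus_conjBy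

theorem MixedExp.hasKraus_sem_tryCatch {Δ₀ Δ₁ : Ctx X} {e₀ e₁ : Exp X} {T : Ty}
    (hΔ : Ctx.WF (Δ₀ ++ Δ₁)) (d₀ : MixedExp Δ₀ e₀ T) (d₁ : MixedExp Δ₁ e₁ T)
    (h₀ : HasKraus d₀.sem) (h₁ : HasKraus d₁.sem) :
    HasKraus (MixedExp.tryCatch hΔ d₀ d₁).sem := by
  have h : (MixedExp.tryCatch hΔ d₀ d₁).sem =
      tryOp d₀.sem d₁.sem ∘ₗ conjBy (basisOp (Ctx.Val.append Δ₀ Δ₁).symm) := by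
    refine superOp_eq_iff.2 fun τ τ' => ?_
    rw [LinearMap.comp_apply, conjBy_basisOp_ketbra, tryOp, superOp_ketbra]
    rfl
  rw [h]
  exact (h₀.tryOp h₁).comp
    (isKraus_basisOp (Ctx.Val.append Δ₀ Δ₁).symm.injective).hasKraus_conjBy

theorem MixedProg.hasKraus_sem_abs {Δ Δ₀ : Ctx X} {e e' : Exp X} {T S : Ty}
    (d : PureExp [] (Δ ++ Δ₀) e T) (d' : MixedExp Δ e' S)
    (h : IsKraus (d.sem Ctx.Val.nil)) (h' : HasKraus d'.sem) :
    HasKraus (MixedProg.abs d d').sem := by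
  have hs : (MixedProg.abs d d').sem = d'.sem ∘ₗ traceRight (Ctx.Val Δ) (Ctx.Val Δ₀) ∘ₗ
      conjBy (basisOp (Ctx.Val.append Δ Δ₀).symm) ∘ₗ conjBy (d.sem Ctx.Val.nil)ᴴ := by
    refine superOp_eq_iff.2 fun v v' => ?_
    simp only [LinearMap.comp_apply, conjBy_apply (d.sem Ctx.Val.nil)ᴴ,
      Matrix.conjTranspose_conjTranspose]
    congr 1
    ext τ τ'
    simp [ptrace, traceRight, conjBy, basisOp, Matrix.mul_apply, Equiv.eq_symm_apply,
      Ctx.Val.cat]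
  rw [hs]
  exact h'.comp (hasKraus_traceRight.comp ((isKraus_basisOp
    (Ctx.Val.append Δ Δ₀).symm.injective).hasKraus_conjBy.comp h.conjTranspose.hasKraus_conjBy))

mutual

theorem PureExp.isKraus_sem : ∀ {Γ Δ : Ctx X} {e : Exp X} {T : Ty} (d : PureExp Γ Δ e T)
    (σ : Ctx.Val Γ), IsKraus (d.sem σ)
  | _, _, _, _, .unit _, _ => isKraus_basisOp fun _ _ _ => rfl
  | _, _, _, _, .cvar _, _ => isKraus_basisOp fun _ _ _ => rfl
  | _, _, _, _, .qvar _ _, _ => isKraus_basisOp fun _ _ h => Prod.ext h rfl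
  | _, _, _, _, .pair hΔ d₀ d₁, σ =>
      PureExp.isKraus_sem_pair hΔ d₀ d₁ σ (d₀.isKraus_sem σ) (d₁.isKraus_sem σ)
  | _, _, _, _, .ctrl hΓ hΔ d ho dp he db, σ =>
      PureExp.isKraus_sem_ctrl hΓ hΔ d ho dp he db d.hasKraus_sem
        (fun j σ' => (db j).isKraus_sem σ') σ
  | _, _, _, _, .app df de, σ => df.isKraus_sem.mul (de.isKraus_sem σ)
  | _, _, _, _, .perm πg πd d, σ =>
      PureExp.isKraus_sem_perm πg πd d σ (d.isKraus_sem _)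

theorem MixedExp.hasKraus_sem : ∀ {Δ : Ctx X} {e : Exp X} {T : Ty} (d : MixedExp Δ e T),
    HasKraus d.sem
  | _, _, _, .mix d => by
      rw [MixedExp.sem, superOp_mul_ketbra_mul]
      exact (d.isKraus_sem _).hasKraus_conjBy
  | _, _, _, .perm π d => MixedExp.hasKraus_sem_perm π d d.hasKraus_sem
  | _, _, _, .pair hΔ d₀ d₁ =>
      MixedExp.hasKraus_sem_pair hΔ d₀ d₁ d₀.hasKraus_sem d₁.hasKraus_sem
  | _, _, _, .tryCatch hΔ d₀ d₁ =>
      MixedExp.hasKraus_sem_tryCatch hΔ d₀ d₁ d₀.hasKraus_sem d₁.hasKraus_sem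
  | _, _, _, .app df de => df.hasKraus_sem.comp de.hasKraus_sem

theorem PureProg.isKraus_sem : ∀ {f : Prog X} {T T' : Ty} (d : PureProg f T T'), IsKraus d.sem
  | _, _, _, .gate rθ rφ rl => isKraus_u3Matrix rθ rφ rl
  | _, _, _, .left _ _ => isKraus_basisOp Sum.inl_injective
  | _, _, _, .right _ _ => isKraus_basisOp Sum.inr_injective
  | _, _, _, .abs d d' => (d'.isKraus_sem _).mul (d.isKraus_sem _).conjTranspose
  | _, _, _, .rphase r s d => (d.isKraus_sem _).phase_combination r s

theorem MixedProg.hasKraus_sem : ∀ {f : Prog X} {T T' : Ty} (d : MixedProg f T T'),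
    HasKraus d.sem
  | _, _, _, .channel d => by
      rw [MixedProg.sem, superOp_mul_ketbra_mul]
      exact d.isKraus_sem.hasKraus_conjBy
  | _, _, _, .abs d d' => MixedProg.hasKraus_sem_abs d d' (d.isKraus_sem _) d'.hasKraus_sem

end

end Qunity

theorem mainTheorem3 {X : Type*} :
    (∀ (Γ Δ : Qunity.Ctx X) (e : Qunity.Exp X) (T : Qunity.Ty) (d : Qunity.PureExp Γ Δ e T)
      (σ : Qunity.Ctx.Val Γ), Qunity.IsKraus (d.sem σ)) ∧
    (∀ (f : Qunity.Prog X) (T T' : Qunity.Ty) (d : Qunity.PureProg f T T'),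
      Qunity.IsKraus d.sem) ∧
    (∀ (Δ : Qunity.Ctx X) (e : Qunity.Exp X) (T : Qunity.Ty) (d : Qunity.MixedExp Δ e T),
      Qunity.IsCompletelyPositive d.sem ∧ Qunity.IsTraceNonIncreasing d.sem) ∧
    (∀ (f : Qunity.Prog X) (T T' : Qunity.Ty) (d : Qunity.MixedProg f T T'),
      Qunity.IsCompletelyPositive d.sem ∧ Qunity.IsTraceNonIncreasing d.sem) :=
  ⟨fun _ _ _ _ d σ => d.isKraus_sem σ, fun _ _ _ d => d.isKraus_sem,
    fun _ _ _ d => ⟨d.hasKraus_sem.isCompletelyPositive, d.hasKraus_sem.isTraceNonIncreasing⟩,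
    fun _ _ _ d => ⟨d.hasKraus_sem.isCompletelyPositive, d.hasKraus_sem.isTraceNonIncreasing⟩⟩
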